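/- Let $n,N\ge 1$ and $N_y\ge 0$ be integers. For each time $t$ let $\mathcal G(t)$ be an undirected simple graph on $\{1,\dots,n\}$ with an arbitrary orientation of its edges, oriented incidence matrix $D(t)$ ($+1$ at the source, $-1$ at the sink of an edge, $0$ elsewhere) and Laplacian $L(t)=D(t)D(t)^\top$, and let $C_i(t)\in\mathbb R^{N_y\times N}$, $i=1,\dots,n$; all depend measurably on $t$. Let $\Gamma_i\in\mathbb R^{N\times N}$ be symmetric positive definite and $\alpha>0$. Put $\bar\Gamma=\mathrm{diag}(\Gamma_1,\dots,\Gamma_n)$, $\bar C(t)=\mathrm{diag}(C_1(t),\dots,C_n(t))$ and $\bar\Lambda(t)=\begin{bmatrix}\bar C(t)\\ \sqrt\alpha\,D(t)^\top\otimes I_N\end{bmatrix}$. Norms are Euclidean, matrix norms are the induced ones. Assume that there are constants $T>0$, $\bar\iota_1\ge\underline\iota_1>0$, $\underline\lambda>0$, $r_2>0$, $r_3>0$ such that (i) $\bar\iota_1 I_N\ge\int_{t-T}^t\sum_{i=1}^n C_i(s)^\top C_i(s)\,ds\ge\underline\iota_1 I_N$ for all $t\ge T$; (ii) $\|C_i(t)^\top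 C_i(t)\|\le r_2$ for all $t\ge0$ and all $i$; (iii) for all $t\ge T$, the matrix $\int_{t-T}^t L(s)\,ds$ has $0$ as a simple eigenvalue and all its other eigenvalues are at least $\underline\lambda$; and $\|L(t)\|\le r_3$ for all $t\ge0$. Define $r_1=\|\bar\Gamma\|$, $r_4=r_2+\alpha r_3$, $\bar\iota_2=Tr_4$, $$\underline\iota_2=\min_{a\in\mathbb R^N,\ \|a\|^2\le1}\max\Big\{\alpha\underline\lambda(1-\|a\|^2),\ \tfrac{\underline\iota_1}{n}\|a\|^2-2r_2T\sqrt{\|a\|^2(1-\|a\|^2)}\Big\},$$ $$\varphi_1=\tfrac12r_1^2\bar\iota_2^2,\qquad \varphi_2=\tfrac14\big(e^{2r_1\bar\iota_2}-1\big)-\tfrac12r_1\bar\iota_2,\qquad \bar\iota_3=\Big(\sqrt{\bar\iota_2-\underline\iota_2+\varphi_2\underline\iota_2}+\sqrt{\bar\iota_2}\Big)^2,$$ $$\underline\iota_3=\begin{cases}\Big(\dfrac{\sqrt{\bar\iota_2-\underline\iota_2+\varphi_1\underline\iota_2}-\sqrt{\bar\iota_2}}{\varphi_1-1}\Big)^2&\text{if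 }\varphi_1\ne1,\\[2ex] \dfrac{\underline\iota_2^2}{4\bar\iota_2}&\text{if }\varphi_1=1,\end{cases}$$ $$\kappa_1=\tfrac T2\lambda_{\max}(\bar\Gamma^{-1})+T\bar\iota_3,\qquad \kappa_2=\tfrac T2\lambda_{\min}(\bar\Gamma^{-1}).$$ Consider the error dynamics with an affine disturbance, $$\dot{\tilde x}(t)=-\bar\Gamma\bar\Lambda(t)^\top\bar\Lambda(t)\tilde x(t)+\delta_{\mathrm{ISS}}(t),\qquad \tilde x(t)\in\mathbb R^{nN}.$$ This system is input-to-state stable, and its linear ISS gain from $\delta_{\mathrm{ISS}}$ to $\tilde x$ is at most $g=\frac{2\kappa_1}{\underline\iota_3}\sqrt{\frac{\kappa_1}{\kappa_2}}$. That is, there is a class-$\mathcal{KL}$ function $\beta$ such that for every $t_0\ge0$, every initial state and every bounded measurable $\delta_{\mathrm{ISS}}$, a (Carathéodory) solution exists on $[t_0,\infty)$ and every solution satisfies, for all $t\ge t_0$, $$\|\tilde x(t)\|\le\beta(\|\tilde x(t_0)\|,t-t_0)+g\sup_{t_0\le\tau\le t}\|\delta_{\mathrm{ISS}}(\tau)\|;$$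 in particular the ISS gain $\gamma_{\mathrm{ISS}}$, the infimum of all $g'>0$ for which this holds with $g'$ in place of $g$ and some class-$\mathcal{KL}$ function $\beta$, satisfies $\gamma_{\mathrm{ISS}}\le g$. -/

import Mathlib

open scoped Matrix Kronecker Topology

noncomputable section

namespace CIEstimator

/-! ### Input-to-state stability of `x' = f(t, x, u)` -/

/-- Class `K`: continuous and strictly increasing on `[0, ∞)`, zero at zero. -/
def ClassK (γ : ℝ → ℝ) : Prop :=
  ContinuousOn γ (Set.Ici 0) ∧ StrictMonoOn γ (Set.Ici 0) ∧ γ 0 = 0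

/-- Class `KL`: class `K` in the first argument, decreasing to zero in the second one. -/
def ClassKL (β : ℝ → ℝ → ℝ) : Prop :=
  (∀ s, 0 ≤ s → ClassK (fun r => β r s)) ∧
  (∀ r, 0 ≤ r → AntitoneOn (β r) (Set.Ici 0) ∧ Filter.Tendsto (β r) Filter.atTop (𝓝 0))

section ISS

variable {E U : Type*} [NormedAddCommGroup E] [NormedSpace ℝ E]
  [NormedAddCommGroup U] [MeasurableSpace U]

/-- `x` is a (Carathéodory) solution on `[t₀, ∞)` of `x' = f(t, x, u(t))`, `x(t₀) = x₀`. -/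
def IsSolution (f : ℝ → E → U → E) (u : ℝ → U) (t₀ : ℝ) (x₀ : E) (x : ℝ → E) : Prop :=
  ContinuousOn x (Set.Ici t₀) ∧
  ∀ t, t₀ ≤ t →
    IntervalIntegrable (fun s => f s (x s) (u s)) MeasureTheory.volume t₀ t ∧
    x t = x₀ + ∫ s in t₀..t, f s (x s) (u s)

/-- For all initial times, initial states and bounded measurable inputs a solution exists on
`[t₀, ∞)`, and every solution satisfies
`‖x(t)‖ ≤ β(‖x(t₀)‖, t - t₀) + γ(sup_{t₀ ≤ τ ≤ t} ‖u(τ)‖)`. -/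
def ISSEstimate (f : ℝ → E → U → E) (β : ℝ → ℝ → ℝ) (γ : ℝ → ℝ) : Prop :=
  ∀ (t₀ : ℝ) (x₀ : E) (u : ℝ → U), 0 ≤ t₀ → Measurable u →
    BddAbove ((fun τ => ‖u τ‖) '' Set.Ici t₀) →
    (∃ x, IsSolution f u t₀ x₀ x) ∧
    ∀ x, IsSolution f u t₀ x₀ x → ∀ t, t₀ ≤ t →
      ‖x t‖ ≤ β ‖x t₀‖ (t - t₀) + γ (sSup ((fun τ => ‖u τ‖) '' Set.Icc t₀ t))

/-- Input-to-state stability. -/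
def IsISS (f : ℝ → E → U → E) : Prop :=
  ∃ β γ, ClassKL β ∧ ClassK γ ∧ ISSEstimate f β γ

/-- The system is input-to-state stable with the linear gain function `r ↦ g r`. -/
def IsISSGain (f : ℝ → E → U → E) (g : ℝ) : Prop :=
  0 < g ∧ ∃ β, ClassKL β ∧ ISSEstimate f β (fun r => g * r)

/-- The (linear) ISS gain: the infimum of all admissible linear gains. -/
def issGain (f : ℝ → E → U → E) : ℝ := sInf {g | IsISSGain f g}

end ISS

/-! ### Matrices -/

/-- The matrix norm induced by the Euclidean norm. -/
def specNorm {ι : Type*} [Fintype ι] [DecidableEq ι] (A : Matrix ι ι ℝ) : ℝ :=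
  ‖Matrix.toEuclideanCLM (n := ι) (𝕜 := ℝ) A‖

/-- Largest (real) eigenvalue. -/
def lambdaMax {ι : Type*} [Fintype ι] [DecidableEq ι] (A : Matrix ι ι ℝ) : ℝ :=
  sSup (spectrum ℝ A)

/-- Smallest (real) eigenvalue. -/
def lambdaMin {ι : Type*} [Fintype ι] [DecidableEq ι] (A : Matrix ι ι ℝ) : ℝ :=
  sInf (spectrum ℝ A)

/-- Entrywise integral `∫_a^b A(s) ds` of a matrix-valued function. -/
def matIntegral {ι κ : Type*} (A : ℝ → Matrix ι κ ℝ) (a b : ℝ) : Matrix ι κ ℝ :=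
  Matrix.of fun i j => ∫ s in a..b, A s i j

/-- The block diagonal matrix `diag(A₁, …, Aₙ)`, rows and columns indexed by (block, entry). -/
def diagBlocks {n p q : ℕ} (A : Fin n → Matrix (Fin p) (Fin q) ℝ) :
    Matrix (Fin n × Fin p) (Fin n × Fin q) ℝ :=
  Matrix.reindex (Equiv.prodComm _ _) (Equiv.prodComm _ _) (Matrix.blockDiagonal A)

/-! ### Graphs -/

/-- An orientation of the edges of a graph. -/
structure EdgeOrientation {V : Type*} (G : SimpleGraph V) where
  /-- The source of an edge. -/
  source : G.edgeSet → V
  /-- The sink of an edge. -/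
  sink : G.edgeSet → V
  ends_eq : ∀ e : G.edgeSet, s(source e, sink e) = (e : Sym2 V)

/-- The oriented incidence matrix. -/
def incidence {n : ℕ} {G : SimpleGraph (Fin n)} (o : EdgeOrientation G) :
    Matrix (Fin n) G.edgeSet ℝ :=
  Matrix.of fun i e => if i = o.source e then 1 else if i = o.sink e then -1 else 0

open Classical in
/-- The Laplacian `L = D Dᵀ`. -/
def laplacian {n : ℕ} {G : SimpleGraph (Fin n)} (o : EdgeOrientation G) :
    Matrix (Fin n) (Fin n) ℝ :=
  incidence o * (incidence o)ᵀ

/-! ### The consensus + innovation estimator -/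

/-- The data of the estimator: `n` agents, local outputs in `ℝ^Ny`, parameters in `ℝ^N`. -/
structure Network (n Ny N : ℕ) where
  /-- The communication graph `G(t)`. -/
  graph : ℝ → SimpleGraph (Fin n)
  /-- An arbitrary orientation of `G(t)`. -/
  orient : ∀ t, EdgeOrientation (graph t)
  /-- The local regressors `C_i(t)`. -/
  C : Fin n → ℝ → Matrix (Fin Ny) (Fin N) ℝ
  /-- The gradient descent gains `Γ_i`. -/
  Γ : Fin n → Matrix (Fin N) (Fin N) ℝ
  /-- The consensus gain `α`. -/
  α : ℝ

namespace Network

variable {n Ny N : ℕ} (S : Network n Ny N)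

/-- `Γ̄ = diag(Γ₁, …, Γₙ)`. -/
def Gam : Matrix (Fin n × Fin N) (Fin n × Fin N) ℝ := diagBlocks S.Γ

/-- `C̄(t) = diag(C₁(t), …, Cₙ(t))`. -/
def Cbar (t : ℝ) : Matrix (Fin n × Fin Ny) (Fin n × Fin N) ℝ := diagBlocks fun i => S.C i t

/-- The Laplacian `L(t)` of `G(t)`. -/
def L (t : ℝ) : Matrix (Fin n) (Fin n) ℝ := laplacian (S.orient t)

/-- `Λ̄(t)`: the block `C̄(t)` on top of the block `√α D(t)ᵀ ⊗ I_N`. -/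
def Lam (t : ℝ) :
    Matrix ((Fin n × Fin Ny) ⊕ ((S.graph t).edgeSet × Fin N)) (Fin n × Fin N) ℝ :=
  Matrix.fromRows (S.Cbar t)
    (Real.sqrt S.α • ((incidence (S.orient t))ᵀ ⊗ₖ (1 : Matrix (Fin N) (Fin N) ℝ)))

open Classical in
/-- Right-hand side of the disturbed error dynamics `x' = -Γ̄ Λ̄(t)ᵀ Λ̄(t) x + δ(t)`. -/
def errorField (t : ℝ) (x δ : EuclideanSpace ℝ (Fin n × Fin N)) :
    EuclideanSpace ℝ (Fin n × Fin N) :=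
  Matrix.toEuclideanCLM (n := Fin n × Fin N) (𝕜 := ℝ)
    (-(S.Gam * (S.Lam t)ᵀ * S.Lam t)) x + δ

end Network

/-! ### The constants -/

/-- `r₄ = r₂ + α r₃`. -/
def r4 (α r₂ r₃ : ℝ) : ℝ := r₂ + α * r₃

/-- Upper bound `T r₄` for the Gramian `∫ Λ̄ᵀ Λ̄`. -/
def iota2Up (T α r₂ r₃ : ℝ) : ℝ := T * r4 α r₂ r₃

/-- Lower bound for the Gramian `∫ Λ̄ᵀ Λ̄`: a minimum over the closed unit ball of `ℝ^N`. -/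
def iota2Lo (n N : ℕ) (T α ι₁ lam r₂ : ℝ) : ℝ :=
  sInf ((fun a : EuclideanSpace ℝ (Fin N) =>
    max (α * lam * (1 - ‖a‖ ^ 2))
      (ι₁ / n * ‖a‖ ^ 2 - 2 * r₂ * T * Real.sqrt (‖a‖ ^ 2 * (1 - ‖a‖ ^ 2)))) ''
    {a | ‖a‖ ^ 2 ≤ 1})

/-- `φ₁`, with `b` the upper bound of the Gramian. -/
def phi1 (r₁ b : ℝ) : ℝ := 1 / 2 * r₁ ^ 2 * b ^ 2

/-- `φ₂`, with `b` the upper bound of the Gramian. -/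
def phi2 (r₁ b : ℝ) : ℝ := 1 / 4 * (Real.exp (2 * r₁ * b) - 1) - 1 / 2 * r₁ * b

/-- `ῑ₃`, as a function of the bounds `c ≤ b` of the Gramian. -/
def iota3Up (r₁ b c : ℝ) : ℝ :=
  (Real.sqrt (b - c + phi2 r₁ b * c) + Real.sqrt b) ^ 2

open Classical in
/-- `ι̲₃`, as a function of the bounds `c ≤ b` of the Gramian. The value at `φ₁ = 1` is the
limit of the other branch. -/
def iota3Lo (r₁ b c : ℝ) : ℝ :=
  if phi1 r₁ b = 1 then c ^ 2 / (4 * b)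
  else ((Real.sqrt (b - c + phi1 r₁ b * c) - Real.sqrt b) / (phi1 r₁ b - 1)) ^ 2

/-- `κ₁ = (T/2) λ_max(Γ̄⁻¹) + T ῑ₃`. -/
def kappa1 {ι : Type*} [Fintype ι] [DecidableEq ι] (T : ℝ) (Γ : Matrix ι ι ℝ) (ι₃ : ℝ) : ℝ :=
  T / 2 * lambdaMax Γ⁻¹ + T * ι₃

/-- `κ₂ = (T/2) λ_min(Γ̄⁻¹)`. -/
def kappa2 {ι : Type*} [Fintype ι] [DecidableEq ι] (T : ℝ) (Γ : Matrix ι ι ℝ) : ℝ :=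
  T / 2 * lambdaMin Γ⁻¹

end CIEstimator

end

/-! Put A(t) = Λ̄ᵀΛ̄, which is `gram`. The error system is x' = -Γ̄A(t)x + δ, and V(x) = ⟪x, Γ̄⁻¹x⟫
satisfies V' = -2⟪x, Ax⟫ when δ = 0. So V contracts over each window of length T once the output
energy ∫⟪z, Az⟫ along a trajectory controls ‖z₀‖².

For a frozen vector that control is `Network.excitation`. Split the stacked vector into the mean of
its blocks and the deviations from it: the integrated Laplacian sees the deviations
(`spectral_gap`), the summed regressors see the mean, and ι̲₂ is the worst case over how the unit
norm is shared between the two. `GradFlow.observability` passes from frozen vectors to trajectories: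
the state can move only if ΓAz is nonzero, hence only at the price of output energy, and this costs
a factor (1 + √φ₁)². By `iota3Lo_mul_le`, ι̲₃ is at most ι̲₂/(1 + √φ₁)².

Let p, P be the extreme eigenvalues of Γ̄⁻¹ and D a bound of the input. The unforced flow multiplies
√V by at most 1 - ι̲₃/P per window (`wnorm_unforced_window`), while the forced response started at
rest adds at most √P·D·T (`wnorm_forced_le`). Summing the geometric series (`wnorm_iterate`) and
returning to the Euclidean norm gives the gain (TP/ι̲₃)√(P/p). It is at most g because 2κ₁ ≥ TP and
κ₂ = Tp/2; the constant ῑ₃ enters only as a nonnegative summand of κ₁. -/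

namespace CIEstimator

set_option linter.unusedSectionVars false

open MeasureTheory
-- Absolutely continuous curves, integral inequalities and semidefinite forms.
section Calculus

variable {E F : Type*} [NormedAddCommGroup E] [InnerProductSpace ℝ E] [FiniteDimensional ℝ E]
  [NormedAddCommGroup F] [NormedSpace ℝ F]

/-- A bounded measurable family of operators applied to a continuous curve is integrable. -/
theorem intervalIntegrable_clm_apply {B : ℝ → E →L[ℝ] F} (hB : StronglyMeasurable B) {K a b : ℝ}
    (hab : a ≤ b) (hK : ∀ t ∈ Set.Icc a b, ‖B t‖ ≤ K) {z : ℝ → E}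
    (hz : ContinuousOn z (Set.Icc a b)) :
    IntervalIntegrable (fun s => B s (z s)) volume a b := by
  rw [intervalIntegrable_iff_integrableOn_Icc_of_le hab]
  obtain ⟨Z, hZ⟩ := isCompact_Icc.exists_bound_of_continuousOn hz
  refine IntegrableOn.of_bound measure_Icc_lt_top ?_ (K * Z) ?_
  · exact isBoundedBilinearMap_apply.continuous.comp_aestronglyMeasurable₂
      hB.aestronglyMeasurable (hz.aestronglyMeasurable measurableSet_Icc)
  · filter_upwards [ae_restrict_mem measurableSet_Icc] with t ht
    calc ‖B t (z t)‖ ≤ ‖B t‖ * ‖z t‖ := (B t).le_opNorm _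
      _ ≤ K * Z := mul_le_mul (hK t ht) (hZ t ht) (norm_nonneg _)
        ((norm_nonneg _).trans (hK t ht))

theorem intervalIntegrable_clm_comp (f : E →L[ℝ] F) {v : ℝ → E} {a b : ℝ}
    (hv : IntervalIntegrable v volume a b) : IntervalIntegrable (fun s => f (v s)) volume a b :=
  ⟨f.integrable_comp hv.1, f.integrable_comp hv.2⟩

/-- Product rule for two functionals of an absolutely continuous curve. -/
theorem clm_mul_clm_eq_integral {x v : ℝ → E} {x₀ : E} {a b : ℝ} (hab : a ≤ b)
    (hv : IntervalIntegrable v volume a b)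
    (hx : ∀ t ∈ Set.Icc a b, x t = x₀ + ∫ s in a..t, v s) (f g : E →L[ℝ] ℝ) :
    f (x b) * g (x b) - f (x a) * g (x a) = ∫ s in a..b, (f (v s) * g (x s) + f (x s) * g (v s)) := by
  -- The curve is an integral only on `[a, b]`, so the scalar product rule is applied to globally
  -- defined primitives that agree with `f ∘ x` there.
  have ac : ∀ f : E →L[ℝ] ℝ,
      AbsolutelyContinuousOnInterval (fun t => f x₀ + ∫ s in a..t, f (v s)) a b := by
    intro f
    have h1 : AbsolutelyContinuousOnInterval (fun t => ∫ s in a..t, f (v s)) a b :=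
      IntervalIntegrable.absolutelyContinuousOnInterval_intervalIntegral
        (intervalIntegrable_clm_comp f hv) (by simp)
    have h2 : AbsolutelyContinuousOnInterval (fun _ : ℝ => f x₀) a b :=
      (LipschitzWith.const (f x₀)).lipschitzOnWith.absolutelyContinuousOnInterval
    exact h2.add h1
  have hfx : ∀ f : E →L[ℝ] ℝ, ∀ t ∈ Set.Icc a b, f (x t) = f x₀ + ∫ s in a..t, f (v s) := by
    intro f t ht
    rw [hx t ht, map_add, f.intervalIntegral_comp_comm]
    exact hv.mono_set (by rw [Set.uIcc_of_le ht.1, Set.uIcc_of_le hab]; exact Set.Icc_subset_Icc_right ht.2)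
  have key := (ac f).integral_deriv_mul_eq_sub (ac g)
  rw [← hfx f b ⟨hab, le_rfl⟩, ← hfx g b ⟨hab, le_rfl⟩, ← hfx f a ⟨le_rfl, hab⟩,
    ← hfx g a ⟨le_rfl, hab⟩] at key
  rw [← key]
  apply intervalIntegral.integral_congr_ae
  have hd : ∀ f : E →L[ℝ] ℝ, ∀ᵐ t, t ∈ Set.uIcc a b →
      deriv (fun t => f x₀ + ∫ s in a..t, f (v s)) t = f (v t) := by
    intro f
    filter_upwards [(intervalIntegrable_clm_comp f hv).ae_hasDerivAt_integral] with t ht hmem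
    exact ((ht hmem a (by simp)).const_add _).deriv
  filter_upwards [hd f, hd g] with t h1 h2 ht
  have ht' := Set.uIoc_subset_uIcc ht
  rw [h1 ht', h2 ht']
  rw [Set.uIcc_of_le hab] at ht'
  rw [← hfx f t ht', ← hfx g t ht']

theorem continuousOn_of_eq_integral {x v : ℝ → E} {x₀ : E} {a b : ℝ} (hab : a ≤ b)
    (hv : IntervalIntegrable v volume a b)
    (hx : ∀ t ∈ Set.Icc a b, x t = x₀ + ∫ s in a..t, v s) : ContinuousOn x (Set.Icc a b) := by
  have h := intervalIntegral.continuousOn_primitive_interval' hv Set.left_mem_uIcc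
  rw [Set.uIcc_of_le hab] at h
  exact (continuousOn_const.add h).congr hx

/-- Energy identity for a symmetric quadratic form along an absolutely continuous curve. -/
theorem quadratic_sub_eq_integral {x v : ℝ → E} {x₀ : E} {a b : ℝ} (hab : a ≤ b)
    (hv : IntervalIntegrable v volume a b)
    (hx : ∀ t ∈ Set.Icc a b, x t = x₀ + ∫ s in a..t, v s) (Q : E →L[ℝ] E)
    (hQ : ∀ x y, inner ℝ (Q x) y = inner ℝ x (Q y)) :
    inner ℝ (x b) (Q (x b)) - inner ℝ (x a) (Q (x a)) = ∫ s in a..b, 2 * inner ℝ (Q (x s)) (v s) := by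
  -- Coordinates turn the form into a finite sum of products of functionals, to which the scalar
  -- product rule applies.
  let e := stdOrthonormalBasis ℝ E
  have hsum : ∀ u w : E, inner ℝ u (Q w) =
      ∑ i, (innerSL ℝ (e i)) u * ((innerSL ℝ (e i)).comp Q) w := by
    intro u w
    rw [← e.sum_inner_mul_inner u (Q w)]
    simp [real_inner_comm]
  have hxc := continuousOn_of_eq_integral hab hv hx
  rw [← Set.uIcc_of_le hab] at hxc
  have hint : ∀ i, IntervalIntegrable (fun s => (innerSL ℝ (e i)) (v s) * ((innerSL ℝ (e i)).comp Q) (x s)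
      + (innerSL ℝ (e i)) (x s) * ((innerSL ℝ (e i)).comp Q) (v s)) volume a b := by
    intro i
    refine IntervalIntegrable.add ?_ ?_
    · exact (intervalIntegrable_clm_comp (innerSL ℝ (e i)) hv).mul_continuousOn
        (((innerSL ℝ (e i)).comp Q).continuous.comp_continuousOn hxc)
    · exact (intervalIntegrable_clm_comp ((innerSL ℝ (e i)).comp Q) hv).continuousOn_mul
        ((innerSL ℝ (e i)).continuous.comp_continuousOn hxc)
  rw [hsum, hsum, ← Finset.sum_sub_distrib]
  rw [Finset.sum_congr rfl fun i _ => clm_mul_clm_eq_integral hab hv hx (innerSL ℝ (e i)) _,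
    ← intervalIntegral.integral_finsetSum fun i _ => hint i]
  congr 1
  ext s
  rw [Finset.sum_add_distrib, ← hsum, ← hsum, ← hQ (x s), two_mul,
    real_inner_comm (v s) (Q (x s))]

/-- Cauchy-Schwarz for the square of an integral. -/
theorem sq_integral_le {f : ℝ → ℝ} {a b : ℝ} (hab : a ≤ b) (hf : IntervalIntegrable f volume a b)
    (hf2 : IntervalIntegrable (fun s => f s ^ 2) volume a b) :
    (∫ s in a..b, f s) ^ 2 ≤ (b - a) * ∫ s in a..b, f s ^ 2 := by
  rcases hab.eq_or_lt with rfl | h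
  · simp
  -- `m` is the mean of `f`; the inequality is nonnegativity of the variance.
  set m := (∫ s in a..b, f s) / (b - a) with hm
  have hba : 0 < b - a := by linarith
  have h0 : 0 ≤ ∫ s in a..b, (f s - m) ^ 2 :=
    intervalIntegral.integral_nonneg hab fun _ _ => sq_nonneg _
  have h1 : ∫ s in a..b, (f s - m) ^ 2 =
      (∫ s in a..b, f s ^ 2) - 2 * m * (∫ s in a..b, f s) + m ^ 2 * (b - a) := by
    have : (fun s => (f s - m) ^ 2) = fun s => f s ^ 2 - 2 * m * f s + m ^ 2 := by ext; ring
    rw [this, intervalIntegral.integral_add (hf2.sub (hf.const_mul _)) intervalIntegrable_const,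
      intervalIntegral.integral_sub hf2 (hf.const_mul _), intervalIntegral.integral_const_mul,
      intervalIntegral.integral_const, smul_eq_mul]
    ring
  have h2 : (∫ s in a..b, f s) = m * (b - a) := by rw [hm]; field_simp
  rw [h1, h2] at h0
  rw [h2]
  nlinarith

/-- A nonlinear Grönwall estimate: `e² ≤ 2 m ∫ e` implies `e ≤ m t`. -/
theorem le_mul_of_sq_le_integral {e : ℝ → ℝ} {a b m : ℝ} (hm : 0 ≤ m)
    (he : ContinuousOn e (Set.Icc a b)) (he0 : ∀ t ∈ Set.Icc a b, 0 ≤ e t)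
    (h : ∀ t ∈ Set.Icc a b, e t ^ 2 ≤ 2 * m * ∫ s in a..t, e s) {t : ℝ} (ht : t ∈ Set.Icc a b) :
    e t ≤ m * (t - a) := by
  have hat := ht.1
  have hsub : Set.Icc a t ⊆ Set.Icc a b := Set.Icc_subset_Icc_right ht.2
  refine le_of_forall_pos_le_add fun ε hε => ?_
  have het := he.mono hsub
  -- Since `e ≤ √G`, the derivative `m * e / √G` of `√G` is at most `m`. The term `ε ^ 2` keeps `G`
  -- positive, where the root is differentiable, and makes `√G` start at `ε`.
  set G : ℝ → ℝ := fun t => ε ^ 2 + 2 * m * ∫ s in a..t, e s with hG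
  have hint : IntervalIntegrable e volume a t := by
    apply ContinuousOn.intervalIntegrable; rwa [Set.uIcc_of_le hat]
  have hGpos : ∀ s ∈ Set.Icc a t, 0 < G s := by
    intro s hs
    have : 0 ≤ ∫ s in a..s, e s := intervalIntegral.integral_nonneg hs.1 fun r hr =>
      he0 r ⟨hr.1, hr.2.trans (hs.2.trans ht.2)⟩
    positivity
  have hGc : ContinuousOn G (Set.Icc a t) := by
    have := intervalIntegral.continuousOn_primitive_interval' hint Set.left_mem_uIcc
    rw [Set.uIcc_of_le hat] at this
    exact continuousOn_const.add (this.const_mul _)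
  have hGd : ∀ s ∈ Set.Ioo a t, HasDerivAt G (2 * m * e s) s := by
    intro s hs
    have hcs : ContinuousAt e s := het.continuousAt (Icc_mem_nhds hs.1 hs.2)
    have hi : IntervalIntegrable e volume a s := hint.mono_set (by
      rw [Set.uIcc_of_le hs.1.le, Set.uIcc_of_le hat]; exact Set.Icc_subset_Icc_right hs.2.le)
    have hsm : StronglyMeasurableAtFilter e (𝓝 s) volume :=
      ⟨Set.Icc a t, Icc_mem_nhds hs.1 hs.2, het.aestronglyMeasurable measurableSet_Icc⟩
    exact ((intervalIntegral.integral_hasDerivAt_right hi hsm hcs).const_mul _).const_add _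
  have hd : ∀ s ∈ Set.Ioo a t, HasDerivAt (fun s => Real.sqrt (G s)) (2 * m * e s / (2 * Real.sqrt (G s))) s :=
    fun s hs => (hGd s hs).sqrt (hGpos s ⟨hs.1.le, hs.2.le⟩).ne'
  have hmv := Convex.image_sub_le_mul_sub_of_deriv_le (convex_Icc a t)
    (f := fun s => Real.sqrt (G s)) hGc.sqrt (by
      rw [interior_Icc]
      exact fun s hs => (hd s hs).differentiableAt.differentiableWithinAt) (C := m) (by
      rw [interior_Icc]
      intro s hs
      rw [(hd s hs).deriv]
      have hs' : s ∈ Set.Icc a t := ⟨hs.1.le, hs.2.le⟩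
      have hp : 0 < Real.sqrt (G s) := Real.sqrt_pos.2 (hGpos s hs')
      rw [div_le_iff₀ (by positivity)]
      have : e s ≤ Real.sqrt (G s) := Real.le_sqrt_of_sq_le (by
        have := h s (hsub hs'); simp only [hG]; nlinarith)
      nlinarith) a ⟨le_rfl, hat⟩ t ⟨hat, le_rfl⟩ hat
  have h1 : e t ≤ Real.sqrt (G t) := Real.le_sqrt_of_sq_le (by
    have := h t ht; simp only [hG]; nlinarith)
  have h2 : Real.sqrt (G a) = ε := by simp [hG, Real.sqrt_sq hε.le]
  simp only [h2] at hmv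
  linarith

/-- Cauchy-Schwarz for a symmetric positive semidefinite form. -/
theorem sq_inner_clm_le (Q : E →L[ℝ] E) (hQ : ∀ x y, inner ℝ (Q x) y = inner ℝ x (Q y))
    (hQ0 : ∀ x, 0 ≤ inner ℝ x (Q x)) (x y : E) :
    inner ℝ x (Q y) ^ 2 ≤ inner ℝ x (Q x) * inner ℝ y (Q y) := by
  have hxy : inner ℝ y (Q x) = inner ℝ x (Q y) := by rw [← hQ, real_inner_comm]
  have h : ∀ s : ℝ, 0 ≤ inner ℝ x (Q x) * (s * s) + (2 * inner ℝ x (Q y)) * s + inner ℝ y (Q y) := by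
    intro s
    have := hQ0 (s • x + y)
    simp only [map_add, map_smul, inner_add_left, inner_add_right, real_inner_smul_left,
      real_inner_smul_right, hxy] at this
    linarith
  have := discrim_le_zero h
  rw [discrim] at this
  linarith

/-- A positive semidefinite operator bounded by `r` satisfies `‖A x‖² ≤ r ⟪x, A x⟫`. -/
theorem sq_norm_clm_le (A : E →L[ℝ] E) (hA : ∀ x y, inner ℝ (A x) y = inner ℝ x (A y))
    (hA0 : ∀ x, 0 ≤ inner ℝ x (A x)) {r : ℝ} (hr : ‖A‖ ≤ r) (x : E) :
    ‖A x‖ ^ 2 ≤ r * inner ℝ x (A x) := by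
  -- Cauchy-Schwarz for the form of `A` at the pair `A x`, `x`: `‖A x‖⁴` is at most `⟪A x, A (A x)⟫
  -- * ⟪x, A x⟫`, and one factor `‖A x‖²` cancels.
  have h1 := sq_inner_clm_le A hA hA0 (A x) x
  rw [real_inner_self_eq_norm_sq] at h1
  have h2 : inner ℝ (A x) (A (A x)) ≤ r * ‖A x‖ ^ 2 := by
    calc inner ℝ (A x) (A (A x)) ≤ ‖A x‖ * ‖A (A x)‖ := real_inner_le_norm _ _
      _ ≤ ‖A x‖ * (r * ‖A x‖) := by gcongr; exact A.le_of_opNorm_le hr _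
      _ = _ := by ring
  rcases (sq_nonneg ‖A x‖).eq_or_lt with h | h
  · rw [← h]; exact mul_nonneg ((norm_nonneg _).trans hr) (hA0 x)
  · have h3 := mul_le_mul_of_nonneg_right h2 (hA0 x)
    by_contra! hc
    nlinarith

end Calculus

/-! ### Linear integral equations by Picard iteration. -/

section Existence

variable {E : Type*} [NormedAddCommGroup E] [InnerProductSpace ℝ E] [FiniteDimensional ℝ E]

/-- The iterated integrals `y_{k+1}(t) = ∫_{t₀}^t M(s) y_k(s) ds`. -/
noncomputable def picardTerm (M : ℝ → E →L[ℝ] E) (t₀ : ℝ) (y : ℝ → E) : ℕ → ℝ → E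
  | 0 => y
  | k + 1 => fun t => ∫ s in t₀..t, M s (picardTerm M t₀ y k s)

theorem continuousOn_picardTerm {M : ℝ → E →L[ℝ] E} (hM : StronglyMeasurable M) {K : ℝ} {t₀ t₁ : ℝ}
    (h01 : t₀ ≤ t₁) (hK : ∀ t ∈ Set.Icc t₀ t₁, ‖M t‖ ≤ K) {y : ℝ → E}
    (hy : ContinuousOn y (Set.Icc t₀ t₁)) (k : ℕ) :
    ContinuousOn (picardTerm M t₀ y k) (Set.Icc t₀ t₁) := by
  induction k with
  | zero => exact hy
  | succ k ih =>
    have := intervalIntegral.continuousOn_primitive_interval'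
      (intervalIntegrable_clm_apply hM h01 hK ih) Set.left_mem_uIcc
    rwa [Set.uIcc_of_le h01] at this

/-- Each integration over the ordered simplex contributes one factor `K (t - t₀)` and the next
denominator of the factorial, which makes the series converge on every bounded interval. -/
theorem norm_picardTerm_le {M : ℝ → E →L[ℝ] E} {K C : ℝ} {t₀ t₁ : ℝ}
    (hK : ∀ t ∈ Set.Icc t₀ t₁, ‖M t‖ ≤ K) {y : ℝ → E}
    (hy : ∀ t ∈ Set.Icc t₀ t₁, ‖y t‖ ≤ C) (k : ℕ) :
    ∀ t ∈ Set.Icc t₀ t₁, ‖picardTerm M t₀ y k t‖ ≤ C * (K ^ k * (t - t₀) ^ k / k.factorial) := by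
  induction k with
  | zero => simpa [picardTerm] using hy
  | succ k ih =>
    intro t ht
    have hK0 : 0 ≤ K := (norm_nonneg _).trans (hK t ht)
    have hbound : ∀ s ∈ Set.Ioc t₀ t, ‖M s (picardTerm M t₀ y k s)‖ ≤
        (C * K ^ (k + 1) / k.factorial) * (s - t₀) ^ k := by
      intro s hs
      have hs' : s ∈ Set.Icc t₀ t₁ := ⟨hs.1.le, hs.2.trans ht.2⟩
      calc ‖M s (picardTerm M t₀ y k s)‖ ≤ K * (C * (K ^ k * (s - t₀) ^ k / k.factorial)) :=
            ((M s).le_opNorm _).trans (mul_le_mul (hK s hs') (ih s hs') (norm_nonneg _) hK0)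
        _ = _ := by ring
    have h := intervalIntegral.norm_integral_le_of_norm_le (μ := volume) ht.1
      (Filter.Eventually.of_forall hbound)
      ((by fun_prop : Continuous fun s : ℝ => (C * K ^ (k + 1) / k.factorial) * (s - t₀) ^ k).intervalIntegrable t₀ t)
    refine h.trans (le_of_eq ?_)
    rw [intervalIntegral.integral_const_mul,
      intervalIntegral.integral_comp_sub_right (fun s => s ^ k) t₀, integral_pow]
    rw [Nat.factorial_succ]
    push_cast
    have : (k : ℝ) + 1 ≠ 0 := by positivity
    have : (k.factorial : ℝ) ≠ 0 := by positivity
    simp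
    field_simp

/-- A linear integral equation with bounded measurable coefficient is solvable on `[t₀, ∞)`. -/
theorem exists_eq_add_integral_clm {M : ℝ → E →L[ℝ] E} (hM : StronglyMeasurable M) {K : ℝ} {t₀ : ℝ}
    (hK : ∀ t, t₀ ≤ t → ‖M t‖ ≤ K) {y : ℝ → E} (hy : ContinuousOn y (Set.Ici t₀)) :
    ∃ x : ℝ → E, ContinuousOn x (Set.Ici t₀) ∧
      ∀ t, t₀ ≤ t → x t = y t + ∫ s in t₀..t, M s (x s) := by
  set Y := picardTerm M t₀ y with hY
  -- A summable majorant on each compact interval gives both continuity of the sum and the exchange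
  -- of sum and integral.
  have loc : ∀ t₁, t₀ ≤ t₁ → ∃ b : ℕ → ℝ, Summable b ∧ ∀ k, ∀ t ∈ Set.Icc t₀ t₁, ‖Y k t‖ ≤ b k := by
    intro t₁ h01
    obtain ⟨C, hC⟩ := isCompact_Icc.exists_bound_of_continuousOn (hy.mono Set.Icc_subset_Ici_self :
      ContinuousOn y (Set.Icc t₀ t₁))
    have hC0 : 0 ≤ C := (norm_nonneg _).trans (hC t₀ ⟨le_rfl, h01⟩)
    have hK0 : 0 ≤ K := (norm_nonneg _).trans (hK t₀ le_rfl)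
    refine ⟨fun k => C * ((K * (t₁ - t₀)) ^ k / k.factorial),
      (Real.summable_pow_div_factorial _).mul_left C, fun k t ht => ?_⟩
    refine (norm_picardTerm_le (fun t ht => hK t ht.1) hC k t ht).trans ?_
    rw [← mul_pow]
    have : 0 ≤ t - t₀ := by linarith [ht.1]
    have := ht.2
    show _ ≤ C * ((K * (t₁ - t₀)) ^ k / k.factorial)
    gcongr
  have hYc : ∀ t₁, t₀ ≤ t₁ → ∀ k, ContinuousOn (Y k) (Set.Icc t₀ t₁) := fun t₁ h01 k =>
    continuousOn_picardTerm hM h01 (fun t ht => hK t ht.1) (hy.mono Set.Icc_subset_Ici_self) k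
  have hxc : ∀ t₁, t₀ ≤ t₁ → ContinuousOn (fun t => ∑' k, Y k t) (Set.Icc t₀ t₁) := by
    intro t₁ h01
    obtain ⟨b, hb, hYb⟩ := loc t₁ h01
    exact continuousOn_tsum (hYc t₁ h01) hb hYb
  refine ⟨fun t => ∑' k, Y k t, ?_, ?_⟩
  · intro t ht
    have h1 : t ∈ Set.Icc t₀ (t + 1) := ⟨ht, by linarith⟩
    refine (hxc (t + 1) (h1.1.trans h1.2) t h1).mono_of_mem_nhdsWithin ?_
    rw [← Set.Ici_inter_Iic]
    exact Filter.inter_mem self_mem_nhdsWithin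
      (mem_nhdsWithin_of_mem_nhds (Iic_mem_nhds (by linarith)))
  · intro t ht
    obtain ⟨b, hb, hYb⟩ := loc t ht
    have hK0 : 0 ≤ K := (norm_nonneg _).trans (hK t₀ le_rfl)
    have hsum : ∀ s ∈ Set.Icc t₀ t, Summable fun k => Y k s := fun s hs =>
      Summable.of_norm_bounded hb fun k => hYb k s hs
    have hint : HasSum (fun k => ∫ s in t₀..t, M s (Y k s)) (∫ s in t₀..t, M s (∑' k, Y k s)) := by
      refine intervalIntegral.hasSum_integral_of_dominated_convergence (fun k _ => K * b k) ?_ ?_ ?_ ?_ ?_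
      · intro k
        have := (intervalIntegrable_clm_apply hM ht (fun t ht => hK t ht.1) (hYc t ht k))
        rw [intervalIntegrable_iff] at this
        exact this.aestronglyMeasurable
      · intro k
        refine Filter.Eventually.of_forall fun s hs => ?_
        rw [Set.uIoc_of_le ht] at hs
        exact ((M s).le_opNorm _).trans (mul_le_mul (hK s hs.1.le) (hYb k s ⟨hs.1.le, hs.2⟩)
          (norm_nonneg _) hK0)
      · exact Filter.Eventually.of_forall fun s _ => hb.mul_left K
      · exact intervalIntegrable_const
      · refine Filter.Eventually.of_forall fun s hs => ?_
        rw [Set.uIoc_of_le ht] at hs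
        exact (M s).hasSum (hsum s ⟨hs.1.le, hs.2⟩).hasSum
    show (∑' k, Y k t) = _
    rw [(hsum t ⟨ht, le_rfl⟩).tsum_eq_zero_add, ← hint.tsum_eq]
    rfl

end Existence

/-! ### The abstract gradient flow `x' = -Γ A(t) x + u`. -/

section Stability

variable {E : Type*} [NormedAddCommGroup E] [InnerProductSpace ℝ E] [FiniteDimensional ℝ E]

/-- The right-hand side `-Γ A(t) x + u`. -/
def gradField (Γ : E →L[ℝ] E) (A : ℝ → E →L[ℝ] E) (t : ℝ) (x u : E) : E := -(Γ (A t x)) + u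

variable [MeasurableSpace E] [BorelSpace E]

theorem intervalIntegrable_of_norm_le {u : ℝ → E} (hu : Measurable u) {a b D : ℝ} (hab : a ≤ b)
    (hD : ∀ t ∈ Set.Icc a b, ‖u t‖ ≤ D) : IntervalIntegrable u volume a b := by
  rw [intervalIntegrable_iff_integrableOn_Icc_of_le hab]
  refine IntegrableOn.of_bound measure_Icc_lt_top hu.aestronglyMeasurable D ?_
  filter_upwards [ae_restrict_mem measurableSet_Icc] with t ht using hD t ht

theorem IsSolution.restart {f : ℝ → E → E → E} {u : ℝ → E} {t₀ t₁ : ℝ} {x₀ : E} {x : ℝ → E}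
    (h : IsSolution f u t₀ x₀ x) (h01 : t₀ ≤ t₁) : IsSolution f u t₁ (x t₁) x := by
  refine ⟨h.1.mono (Set.Ici_subset_Ici.2 h01), fun t ht => ?_⟩
  obtain ⟨hi, hx⟩ := h.2 t (h01.trans ht)
  obtain ⟨hi1, hx1⟩ := h.2 t₁ h01
  have hi2 := hi1.symm.trans hi
  refine ⟨hi2, ?_⟩
  rw [hx, hx1, add_assoc, intervalIntegral.integral_add_adjacent_intervals hi1 hi2]

theorem IsSolution.initial {f : ℝ → E → E → E} {u : ℝ → E} {t₀ : ℝ} {x₀ : E} {x : ℝ → E}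
    (h : IsSolution f u t₀ x₀ x) : x t₀ = x₀ := by
  simpa using (h.2 t₀ le_rfl).2

/-- The input is absorbed in the inhomogeneity `x₀ + ∫ u`, leaving a linear integral equation with
kernel `-Γ A`. -/
theorem exists_isSolution_gradField {Γ : E →L[ℝ] E} {A : ℝ → E →L[ℝ] E} (hA : StronglyMeasurable A)
    {r : ℝ} (hr : ∀ t, 0 ≤ t → ‖A t‖ ≤ r) {t₀ : ℝ} (ht₀ : 0 ≤ t₀) (x₀ : E) {u : ℝ → E}
    (hu : Measurable u) (hub : BddAbove ((fun τ => ‖u τ‖) '' Set.Ici t₀)) :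
    ∃ x, IsSolution (gradField Γ A) u t₀ x₀ x := by
  obtain ⟨D, hD⟩ := hub
  have hD' : ∀ t, t₀ ≤ t → ‖u t‖ ≤ D := fun t ht => hD ⟨t, ht, rfl⟩
  have hui : ∀ t, t₀ ≤ t → IntervalIntegrable u volume t₀ t := fun t ht =>
    intervalIntegrable_of_norm_le hu ht fun s hs => hD' s hs.1
  have hM : StronglyMeasurable fun t => -(Γ.comp (A t)) :=
    (((ContinuousLinearMap.compL ℝ E E E Γ).continuous.comp_stronglyMeasurable hA)).neg
  have hK : ∀ t, t₀ ≤ t → ‖-(Γ.comp (A t))‖ ≤ ‖Γ‖ * r := by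
    intro t ht
    rw [norm_neg]
    exact (Γ.opNorm_comp_le _).trans (mul_le_mul_of_nonneg_left (hr t (ht₀.trans ht)) (norm_nonneg _))
  have hy : ContinuousOn (fun t => x₀ + ∫ s in t₀..t, u s) (Set.Ici t₀) := by
    intro t ht
    have h1 : t ∈ Set.Icc t₀ (t + 1) := ⟨ht, by linarith⟩
    have h2 := intervalIntegral.continuousOn_primitive_interval' (hui (t + 1) (h1.1.trans h1.2))
      Set.left_mem_uIcc
    rw [Set.uIcc_of_le (h1.1.trans h1.2)] at h2
    refine ((continuousOn_const.add h2) t h1).mono_of_mem_nhdsWithin ?_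
    rw [← Set.Ici_inter_Iic]
    exact Filter.inter_mem self_mem_nhdsWithin
      (mem_nhdsWithin_of_mem_nhds (Iic_mem_nhds (by linarith)))
  obtain ⟨x, hxc, hx⟩ := exists_eq_add_integral_clm hM hK hy
  refine ⟨x, hxc, fun t ht => ?_⟩
  have hi := intervalIntegrable_clm_apply hM ht (fun s hs => hK s hs.1)
    (hxc.mono Set.Icc_subset_Ici_self)
  refine ⟨hi.add (hui t ht), ?_⟩
  have : ∫ s in t₀..t, gradField Γ A s (x s) (u s) =
      (∫ s in t₀..t, (-(Γ.comp (A s))) (x s)) + ∫ s in t₀..t, u s :=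
    intervalIntegral.integral_add hi (hui t ht)
  rw [this, hx t ht]
  abel

/-- The data of the gradient flow `x' = -Γ A(t) x` with a persistently exciting `A`. -/
structure GradFlow (Γ Q : E →L[ℝ] E) (A : ℝ → E →L[ℝ] E) (p P r₁ r c T : ℝ) : Prop where
  inv : ∀ x, Q (Γ x) = x
  symm_Q : ∀ x y, inner ℝ (Q x) y = inner ℝ x (Q y)
  p_pos : 0 < p
  lower_Q : ∀ x, p * ‖x‖ ^ 2 ≤ inner ℝ x (Q x)
  upper_Q : ∀ x, inner ℝ x (Q x) ≤ P * ‖x‖ ^ 2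
  norm_Γ : ‖Γ‖ ≤ r₁
  r₁_pos : 0 < r₁
  r_pos : 0 < r
  meas : StronglyMeasurable A
  symm_A : ∀ t x y, inner ℝ (A t x) y = inner ℝ x (A t y)
  nonneg_A : ∀ t x, 0 ≤ inner ℝ x (A t x)
  norm_A : ∀ t, 0 ≤ t → ‖A t‖ ≤ r
  T_pos : 0 < T
  excite : ∀ t, 0 ≤ t → ∀ x, c * ‖x‖ ^ 2 ≤ ∫ s in t..t + T, inner ℝ x (A s x)

namespace GradFlow

variable {Γ Q : E →L[ℝ] E} {A : ℝ → E →L[ℝ] E} {p P r₁ r c T : ℝ}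

theorem nonneg_Q (h : GradFlow Γ Q A p P r₁ r c T) (x : E) : 0 ≤ inner ℝ x (Q x) :=
  (mul_nonneg h.p_pos.le (sq_nonneg _)).trans (h.lower_Q x)

theorem integrable_A (h : GradFlow Γ Q A p P r₁ r c T) {a b : ℝ} (ha : 0 ≤ a) (hab : a ≤ b)
    {z : ℝ → E} (hz : ContinuousOn z (Set.Icc a b)) :
    IntervalIntegrable (fun s => A s (z s)) volume a b :=
  intervalIntegrable_clm_apply h.meas hab (fun t ht => h.norm_A t (ha.trans ht.1)) hz

theorem integrable_ΓA (h : GradFlow Γ Q A p P r₁ r c T) {a b : ℝ} (ha : 0 ≤ a) (hab : a ≤ b)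
    {z : ℝ → E} (hz : ContinuousOn z (Set.Icc a b)) :
    IntervalIntegrable (fun s => Γ (A s (z s))) volume a b :=
  intervalIntegrable_clm_comp Γ (h.integrable_A ha hab hz)

theorem integrable_quad (h : GradFlow Γ Q A p P r₁ r c T) {a b : ℝ} (ha : 0 ≤ a) (hab : a ≤ b)
    {z : ℝ → E} (hz : ContinuousOn z (Set.Icc a b)) :
    IntervalIntegrable (fun s => inner ℝ (z s) (A s (z s))) volume a b := by
  rw [intervalIntegrable_iff_integrableOn_Icc_of_le hab]
  obtain ⟨Z, hZ⟩ := isCompact_Icc.exists_bound_of_continuousOn hz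
  refine IntegrableOn.of_bound measure_Icc_lt_top ?_ (Z * (r * Z)) ?_
  · have := h.integrable_A ha hab hz
    rw [intervalIntegrable_iff_integrableOn_Icc_of_le hab] at this
    exact (hz.aestronglyMeasurable measurableSet_Icc).inner this.aestronglyMeasurable
  · filter_upwards [ae_restrict_mem measurableSet_Icc] with t ht
    have hr := h.norm_A t (ha.trans ht.1)
    calc ‖inner ℝ (z t) (A t (z t))‖ ≤ ‖z t‖ * ‖A t (z t)‖ := norm_inner_le_norm _ _
      _ ≤ Z * (r * Z) := by
        have h1 := hZ t ht
        have h2 := (A t).le_of_opNorm_le hr (z t)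
        have h3 : 0 ≤ r := (norm_nonneg _).trans hr
        have h4 := norm_nonneg (z t)
        exact mul_le_mul h1 (h2.trans (by gcongr)) (norm_nonneg _) (h4.trans h1)

end GradFlow

end Stability

/-! ### Observability, contraction over windows and the ISS gain. -/

section Gain

variable {E : Type*} [NormedAddCommGroup E] [InnerProductSpace ℝ E] [FiniteDimensional ℝ E]
  [MeasurableSpace E] [BorelSpace E]

namespace GradFlow

variable {Γ Q : E →L[ℝ] E} {A : ℝ → E →L[ℝ] E} {p P r₁ r c T : ℝ}

theorem inner_le (h : GradFlow Γ Q A p P r₁ r c T) {t : ℝ} (ht : 0 ≤ t) (x : E) :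
    inner ℝ x (A t x) ≤ r * ‖x‖ ^ 2 := by
  calc inner ℝ x (A t x) ≤ ‖x‖ * ‖A t x‖ := real_inner_le_norm _ _
    _ ≤ ‖x‖ * (r * ‖x‖) := by gcongr; exact (A t).le_of_opNorm_le (h.norm_A t ht) x
    _ = _ := by ring

/-- Expanding the form at `η • x - d`, which is nonnegative, bounds the cross term. The weight `η`
is left free so that `observability` can choose it. -/
theorem young (h : GradFlow Γ Q A p P r₁ r c T) {η : ℝ} (hη : 0 < η) (t : ℝ) (x d : E) :
    inner ℝ (x + d) (A t (x + d)) ≤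
      (1 + η) * inner ℝ x (A t x) + (1 + 1 / η) * inner ℝ d (A t d) := by
  have h0 := h.nonneg_A t (η • x - d)
  have hs : inner ℝ d (A t x) = inner ℝ x (A t d) := by
    rw [← h.symm_A, real_inner_comm]
  simp only [map_add, map_sub, map_smul, inner_add_left, inner_add_right, inner_sub_left,
    inner_sub_right, real_inner_smul_left, real_inner_smul_right, hs] at h0 ⊢
  have : 0 ≤ η * inner ℝ x (A t x) - 2 * inner ℝ x (A t d) + 1 / η * inner ℝ d (A t d) := by
    have h1 := div_nonneg h0 hη.le
    generalize inner ℝ x (A t x) = X, inner ℝ x (A t d) = Y, inner ℝ d (A t d) = Z at h1 ⊢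
    refine h1.trans (le_of_eq ?_)
    field_simp
    ring
  linarith

theorem integrable_sq_norm_ΓA (h : GradFlow Γ Q A p P r₁ r c T) {a b : ℝ} (ha : 0 ≤ a) (hab : a ≤ b)
    {z : ℝ → E} (hz : ContinuousOn z (Set.Icc a b)) :
    IntervalIntegrable (fun s => ‖Γ (A s (z s))‖ ^ 2) volume a b := by
  have h1 := (intervalIntegrable_iff_integrableOn_Icc_of_le hab).1 (h.integrable_ΓA ha hab hz)
  have h2 := (intervalIntegrable_iff_integrableOn_Icc_of_le hab).1
    ((h.integrable_quad ha hab hz).const_mul (r₁ ^ 2 * r))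
  rw [intervalIntegrable_iff_integrableOn_Icc_of_le hab]
  refine h2.mono' (h1.aestronglyMeasurable.norm.pow 2) ?_
  filter_upwards [ae_restrict_mem measurableSet_Icc] with t ht
  rw [Real.norm_of_nonneg (sq_nonneg _)]
  have h3 := sq_norm_clm_le (A t) (h.symm_A t) (h.nonneg_A t) (h.norm_A t (ha.trans ht.1)) (z t)
  calc ‖Γ (A t (z t))‖ ^ 2 ≤ (r₁ * ‖A t (z t)‖) ^ 2 := by
        gcongr; exact Γ.le_of_opNorm_le h.norm_Γ _
    _ = r₁ ^ 2 * ‖A t (z t)‖ ^ 2 := by ring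
    _ ≤ r₁ ^ 2 * (r * inner ℝ (z t) (A t (z t))) := by gcongr
    _ = _ := by ring

/-- Along the unforced flow the state moves little when little output energy is seen. -/
theorem sq_norm_sub_le (h : GradFlow Γ Q A p P r₁ r c T) {t τ b : ℝ} (ht : 0 ≤ t) (htτ : t ≤ τ)
    (hτb : τ ≤ b) {z₀ : E} {z : ℝ → E} (hz : IsSolution (gradField Γ A) (fun _ => 0) t z₀ z) :
    ‖z₀ - z τ‖ ^ 2 ≤ (τ - t) * (r₁ ^ 2 * r * ∫ s in t..b, inner ℝ (z s) (A s (z s))) := by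
  have hzc : ContinuousOn z (Set.Icc t τ) := hz.1.mono Set.Icc_subset_Ici_self
  have hzcb : ContinuousOn z (Set.Icc t b) := hz.1.mono Set.Icc_subset_Ici_self
  have hd : z₀ - z τ = ∫ s in t..τ, Γ (A s (z s)) := by
    rw [(hz.2 τ htτ).2]
    simp [gradField]
  have h1 : ‖z₀ - z τ‖ ≤ ∫ s in t..τ, ‖Γ (A s (z s))‖ := by
    rw [hd]; exact intervalIntegral.norm_integral_le_integral_norm htτ
  have hi := (h.integrable_ΓA ht htτ hzc).norm
  have hi2 := h.integrable_sq_norm_ΓA ht htτ hzc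
  calc ‖z₀ - z τ‖ ^ 2 ≤ (∫ s in t..τ, ‖Γ (A s (z s))‖) ^ 2 := by gcongr
    _ ≤ (τ - t) * ∫ s in t..τ, ‖Γ (A s (z s))‖ ^ 2 := sq_integral_le htτ hi hi2
    _ ≤ (τ - t) * ∫ s in t..τ, r₁ ^ 2 * r * inner ℝ (z s) (A s (z s)) := by
        refine mul_le_mul_of_nonneg_left ?_ (by linarith)
        refine intervalIntegral.integral_mono_on htτ hi2
          ((h.integrable_quad ht htτ hzc).const_mul _) fun s hs => ?_
        have h3 := sq_norm_clm_le (A s) (h.symm_A s) (h.nonneg_A s) (h.norm_A s (ht.trans hs.1)) (z s)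
        calc ‖Γ (A s (z s))‖ ^ 2 ≤ (r₁ * ‖A s (z s)‖) ^ 2 := by
              gcongr; exact Γ.le_of_opNorm_le h.norm_Γ _
          _ = r₁ ^ 2 * ‖A s (z s)‖ ^ 2 := by ring
          _ ≤ r₁ ^ 2 * (r * inner ℝ (z s) (A s (z s))) := by gcongr
          _ = _ := by ring
    _ ≤ (τ - t) * (r₁ ^ 2 * r * ∫ s in t..b, inner ℝ (z s) (A s (z s))) := by
        rw [intervalIntegral.integral_const_mul]
        have hr := h.r_pos
        have : 0 ≤ τ - t := by linarith
        gcongr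
        refine intervalIntegral.integral_mono_interval le_rfl htτ hτb
          (Filter.Eventually.of_forall fun s => h.nonneg_A s (z s)) (h.integrable_quad ht (htτ.trans hτb) hzcb)

/-- The closed-loop observability Gramian is bounded below. -/
theorem observability (h : GradFlow Γ Q A p P r₁ r c T) {t : ℝ} (ht : 0 ≤ t) {z₀ : E} {z : ℝ → E}
    (hz : IsSolution (gradField Γ A) (fun _ => 0) t z₀ z) :
    c * ‖z₀‖ ^ 2 ≤ (1 + Real.sqrt (1 / 2 * r₁ ^ 2 * (T * r) ^ 2)) ^ 2 *
      ∫ s in t..t + T, inner ℝ (z s) (A s (z s)) := by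
  have hT := h.T_pos
  have hr := h.r_pos
  have hr₁ := h.r₁_pos
  have htT : t ≤ t + T := by linarith
  have hzc : ContinuousOn z (Set.Icc t (t + T)) := hz.1.mono Set.Icc_subset_Ici_self
  set w := ∫ s in t..t + T, inner ℝ (z s) (A s (z s)) with hw
  set φ := 1 / 2 * r₁ ^ 2 * (T * r) ^ 2 with hφ
  have hφ0 : 0 < φ := by positivity
  -- The integrated bound is `(1 + η) + (1 + 1/η) φ` times `w`. Its minimum over `η` is at `η = √φ`,
  -- with value `(1 + √φ)²`. The `1/2` in `φ` comes from integrating `s - t` over the window.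
  set η := Real.sqrt φ with hη
  have hη0 : 0 < η := Real.sqrt_pos.2 hφ0
  have hη2 : η * η = φ := Real.mul_self_sqrt hφ0.le
  have hpt : ∀ s ∈ Set.Icc t (t + T), inner ℝ z₀ (A s z₀) ≤
      (1 + η) * inner ℝ (z s) (A s (z s)) + (1 + 1 / η) * (r ^ 2 * r₁ ^ 2 * w) * (s - t) := by
    intro s hs
    have h1 := h.young hη0 s (z s) (z₀ - z s)
    rw [add_sub_cancel] at h1
    refine h1.trans ?_
    have h2 := h.inner_le (ht.trans hs.1) (z₀ - z s)
    have h3 := h.sq_norm_sub_le ht hs.1 hs.2 hz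
    have h4 : inner ℝ (z₀ - z s) (A s (z₀ - z s)) ≤ (r ^ 2 * r₁ ^ 2 * w) * (s - t) := by
      refine h2.trans ((mul_le_mul_of_nonneg_left h3 hr.le).trans (le_of_eq ?_))
      ring
    have h5 : 0 ≤ 1 + 1 / η := by positivity
    nlinarith [mul_le_mul_of_nonneg_left h4 h5]
  have hlin : IntervalIntegrable (fun s : ℝ => (1 + 1 / η) * (r ^ 2 * r₁ ^ 2 * w) * (s - t)) volume t (t + T) :=
    (by fun_prop : Continuous fun s : ℝ => (1 + 1 / η) * (r ^ 2 * r₁ ^ 2 * w) * (s - t)).intervalIntegrable _ _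
  have hq := (h.integrable_quad ht htT hzc).const_mul (1 + η)
  have hmono := intervalIntegral.integral_mono_on htT
    (h.integrable_quad ht htT (continuousOn_const (c := z₀))) (hq.add hlin) hpt
  have hval : ∫ s in t..t + T, ((1 + η) * inner ℝ (z s) (A s (z s)) +
      (1 + 1 / η) * (r ^ 2 * r₁ ^ 2 * w) * (s - t)) = (1 + η) ^ 2 * w := by
    rw [intervalIntegral.integral_add hq hlin, intervalIntegral.integral_const_mul,
      intervalIntegral.integral_const_mul, intervalIntegral.integral_comp_sub_right (fun s => s) t,
      integral_id, ← hw]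
    have : (1 + 1 / η) * (r ^ 2 * r₁ ^ 2 * w) * ((t + T - t) ^ 2 - (t - t) ^ 2) / 2 =
      (1 + 1 / η) * (η * η) * w := by rw [hη2, hφ]; ring
    rw [mul_div_assoc', this]
    field_simp
    ring
  exact (h.excite t ht z₀).trans (hmono.trans hval.le)

/-- The energy identity for the unforced flow. -/
theorem unforced_energy (h : GradFlow Γ Q A p P r₁ r c T) {t b : ℝ} (htb : t ≤ b)
    {z₀ : E} {z : ℝ → E} (hz : IsSolution (gradField Γ A) (fun _ => 0) t z₀ z) :
    inner ℝ (z b) (Q (z b)) = inner ℝ z₀ (Q z₀) - 2 * ∫ s in t..b, inner ℝ (z s) (A s (z s)) := by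
  have h1 := quadratic_sub_eq_integral htb (hz.2 b htb).1 (fun s hs => (hz.2 s hs.1).2) Q h.symm_Q
  -- `Q` inverts `Γ`, so the gain drops out of the dissipation rate.
  have h2 : ∀ s, 2 * inner ℝ (Q (z s)) (gradField Γ A s (z s) 0) =
      -2 * inner ℝ (z s) (A s (z s)) := by
    intro s
    simp [gradField, h.symm_Q, h.inv]
  simp only [h2, intervalIntegral.integral_const_mul] at h1
  rw [hz.initial] at h1
  linarith

theorem unforced_le (h : GradFlow Γ Q A p P r₁ r c T) {t b : ℝ} (htb : t ≤ b)
    {z₀ : E} {z : ℝ → E} (hz : IsSolution (gradField Γ A) (fun _ => 0) t z₀ z) :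
    inner ℝ (z b) (Q (z b)) ≤ inner ℝ z₀ (Q z₀) := by
  rw [h.unforced_energy htb hz]
  have : 0 ≤ ∫ s in t..b, inner ℝ (z s) (A s (z s)) :=
    intervalIntegral.integral_nonneg htb fun s _ => h.nonneg_A s (z s)
  linarith

/-- The weighted norm `√⟪x, Q x⟫`. -/
noncomputable def wnorm (Q : E →L[ℝ] E) (x : E) : ℝ := Real.sqrt (inner ℝ x (Q x))

theorem sq_wnorm (h : GradFlow Γ Q A p P r₁ r c T) (x : E) :
    wnorm Q x ^ 2 = inner ℝ x (Q x) := Real.sq_sqrt (h.nonneg_Q x)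

theorem inner_le_wnorm (h : GradFlow Γ Q A p P r₁ r c T) (x y : E) :
    inner ℝ x (Q y) ≤ wnorm Q x * wnorm Q y := by
  refine le_of_abs_le (abs_le_of_sq_le_sq ?_ (mul_nonneg (Real.sqrt_nonneg _) (Real.sqrt_nonneg _)))
  rw [mul_pow, h.sq_wnorm, h.sq_wnorm]
  exact sq_inner_clm_le Q h.symm_Q h.nonneg_Q x y

theorem wnorm_add_le (h : GradFlow Γ Q A p P r₁ r c T) (x y : E) :
    wnorm Q (x + y) ≤ wnorm Q x + wnorm Q y := by
  refine (Real.sqrt_le_left (add_nonneg (Real.sqrt_nonneg _) (Real.sqrt_nonneg _))).2 ?_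
  have h1 := h.inner_le_wnorm x y
  have hs : inner ℝ y (Q x) = inner ℝ x (Q y) := by rw [← h.symm_Q, real_inner_comm]
  rw [map_add, inner_add_left, inner_add_right, inner_add_right, hs, add_sq,
    Real.sq_sqrt (h.nonneg_Q x), Real.sq_sqrt (h.nonneg_Q y)]
  simp only [wnorm] at h1
  linarith

theorem P_pos [Nontrivial E] (h : GradFlow Γ Q A p P r₁ r c T) : 0 < P := by
  obtain ⟨x, hx⟩ := exists_ne (0 : E)
  have h1 := (h.lower_Q x).trans (h.upper_Q x)
  have h2 : 0 < ‖x‖ ^ 2 := by positivity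
  exact h.p_pos.trans_le (le_of_mul_le_mul_right h1 h2)

theorem wnorm_le (h : GradFlow Γ Q A p P r₁ r c T) (x : E) :
    wnorm Q x ≤ Real.sqrt P * ‖x‖ := by
  rw [wnorm, ← Real.sqrt_sq (norm_nonneg x), ← Real.sqrt_mul' _ (sq_nonneg _)]
  exact Real.sqrt_le_sqrt (h.upper_Q x)

theorem le_wnorm (h : GradFlow Γ Q A p P r₁ r c T) (x : E) :
    Real.sqrt p * ‖x‖ ≤ wnorm Q x := by
  rw [wnorm, ← Real.sqrt_sq (norm_nonneg x), ← Real.sqrt_mul' _ (sq_nonneg _)]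
  exact Real.sqrt_le_sqrt (h.lower_Q x)

/-- The forced flow started at rest grows at most linearly. -/
theorem wnorm_forced_le (h : GradFlow Γ Q A p P r₁ r c T) {t b D : ℝ} (htb : t ≤ b)
    {u w : ℝ → E} (hu : Measurable u) (hD : ∀ s ∈ Set.Icc t b, ‖u s‖ ≤ D)
    (hwc : ContinuousOn w (Set.Icc t b))
    (hwi : IntervalIntegrable (fun s => gradField Γ A s (w s) (u s)) volume t b)
    (hw : ∀ s ∈ Set.Icc t b, w s = 0 + ∫ τ in t..s, gradField Γ A τ (w τ) (u τ)) :
    wnorm Q (w b) ≤ Real.sqrt P * D * (b - t) := by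
  have hD0 : 0 ≤ D := (norm_nonneg _).trans (hD t ⟨le_rfl, htb⟩)
  have hec : ContinuousOn (fun s => wnorm Q (w s)) (Set.Icc t b) :=
    (hwc.inner (Q.continuous.comp_continuousOn hwc)).sqrt
  -- The integral inequality for the squared weighted norm avoids differentiating the norm at the
  -- origin, where the curve starts.
  refine le_mul_of_sq_le_integral (e := fun s => wnorm Q (w s)) (b := b)
    (mul_nonneg (Real.sqrt_nonneg _) hD0) hec (fun s _ => Real.sqrt_nonneg _) ?_ ⟨htb, le_rfl⟩
  intro s hs
  have hsub : Set.uIcc t s ⊆ Set.uIcc t b := by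
    rw [Set.uIcc_of_le hs.1, Set.uIcc_of_le htb]; exact Set.Icc_subset_Icc_right hs.2
  have hsub' : Set.Icc t s ⊆ Set.Icc t b := Set.Icc_subset_Icc_right hs.2
  have h1 := quadratic_sub_eq_integral hs.1 (hwi.mono_set hsub)
    (fun τ hτ => hw τ (hsub' hτ)) Q h.symm_Q
  have hwt : w t = 0 := by simpa using hw t ⟨le_rfl, htb⟩
  rw [hwt, inner_zero_left, sub_zero] at h1
  show wnorm Q (w s) ^ 2 ≤ _
  rw [h.sq_wnorm, h1, ← intervalIntegral.integral_const_mul]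
  have hcs : ContinuousOn (fun s => wnorm Q (w s)) (Set.uIcc t s) := by
    rw [Set.uIcc_of_le hs.1]; exact hec.mono hsub'
  refine intervalIntegral.integral_mono_on hs.1 ?_ ((hcs.intervalIntegrable).const_mul _) ?_
  · have hui := intervalIntegrable_of_norm_le hu hs.1 fun τ hτ => hD τ (hsub' hτ)
    have hQw : ContinuousOn (fun τ => Q (w τ)) (Set.Icc t s) :=
      Q.continuous.comp_continuousOn (hwc.mono hsub')
    obtain ⟨Z, hZ⟩ := isCompact_Icc.exists_bound_of_continuousOn hQw
    have hv := (hwi.mono_set hsub).norm.const_mul (2 * Z)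
    rw [intervalIntegrable_iff_integrableOn_Icc_of_le hs.1] at hv ⊢
    refine hv.mono' ?_ ?_
    · have := hwi.mono_set hsub
      rw [intervalIntegrable_iff_integrableOn_Icc_of_le hs.1] at this
      exact ((hQw.aestronglyMeasurable measurableSet_Icc).inner this.aestronglyMeasurable).const_mul 2
    · filter_upwards [ae_restrict_mem measurableSet_Icc] with τ hτ
      rw [norm_mul, Real.norm_two, mul_assoc]
      gcongr
      exact (norm_inner_le_norm _ _).trans (by gcongr; exact hZ τ hτ)
  · intro τ hτ
    -- The dissipation has the favourable sign and is discarded; only the input term can increase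
    -- the energy.
    have h2 : inner ℝ (Q (w τ)) (gradField Γ A τ (w τ) (u τ)) =
        -inner ℝ (w τ) (A τ (w τ)) + inner ℝ (w τ) (Q (u τ)) := by
      rw [gradField, inner_add_right, inner_neg_right, h.symm_Q, h.symm_Q, h.inv]
    have h3 := h.inner_le_wnorm (w τ) (u τ)
    have h4 : wnorm Q (u τ) ≤ Real.sqrt P * D :=
      (h.wnorm_le _).trans (mul_le_mul_of_nonneg_left (hD τ (hsub' hτ)) (Real.sqrt_nonneg _))
    have h5 := mul_le_mul_of_nonneg_left h4 (Real.sqrt_nonneg (inner ℝ (w τ) (Q (w τ))))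
    have h6 := h.nonneg_A τ (w τ)
    rw [h2]
    simp only [wnorm] at h3 h5 h4 ⊢
    linarith

/-- A solution splits into the unforced flow and a forced flow started at rest. -/
theorem exists_unforced (h : GradFlow Γ Q A p P r₁ r c T) {t : ℝ} (ht : 0 ≤ t) {u x : ℝ → E}
    (hu : Measurable u) {x₀ : E} (hx : IsSolution (gradField Γ A) u t x₀ x) :
    ∃ z, IsSolution (gradField Γ A) (fun _ => 0) t x₀ z ∧
      ∀ b D, t ≤ b → (∀ s ∈ Set.Icc t b, ‖u s‖ ≤ D) →
        wnorm Q (x b) ≤ wnorm Q (z b) + Real.sqrt P * D * (b - t) := by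
  obtain ⟨z, hz⟩ := exists_isSolution_gradField (Γ := Γ) h.meas h.norm_A ht x₀
    (u := fun _ => (0 : E)) measurable_const ⟨0, by rintro _ ⟨_, _, rfl⟩; simp⟩
  refine ⟨z, hz, fun b D htb hD => ?_⟩
  -- Superposition: the difference of the forced and the unforced solution solves the forced
  -- equation from rest.
  have heq : ∀ s, gradField Γ A s (x s - z s) (u s) =
      gradField Γ A s (x s) (u s) - gradField Γ A s (z s) 0 := by
    intro s; simp only [gradField, map_sub]; abel
  have h1 := h.wnorm_forced_le htb (w := fun s => x s - z s) hu hD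
    ((hx.1.sub hz.1).mono Set.Icc_subset_Ici_self)
    (by simp only [heq]; exact (hx.2 b htb).1.sub (hz.2 b htb).1)
    (fun s hs => by
      simp only [heq]
      rw [intervalIntegral.integral_sub (hx.2 s hs.1).1 (hz.2 s hs.1).1]
      rw [(hx.2 s hs.1).2, (hz.2 s hs.1).2]
      abel)
  have h2 := h.wnorm_add_le (z b) (x b - z b)
  rw [add_sub_cancel] at h2
  linarith

variable {q : ℝ}

/-- `q` is any number below the observability constant, so that `iota3Lo` can be substituted
directly. -/
theorem unforced_window (h : GradFlow Γ Q A p P r₁ r c T)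
    (hq : q * (1 + Real.sqrt (1 / 2 * r₁ ^ 2 * (T * r) ^ 2)) ^ 2 ≤ c) {t : ℝ} (ht : 0 ≤ t)
    {z₀ : E} {z : ℝ → E} (hz : IsSolution (gradField Γ A) (fun _ => 0) t z₀ z) :
    inner ℝ (z (t + T)) (Q (z (t + T))) ≤ inner ℝ z₀ (Q z₀) - 2 * q * ‖z₀‖ ^ 2 := by
  rw [h.unforced_energy (by linarith [h.T_pos]) hz]
  have h1 := h.observability ht hz
  set k := (1 + Real.sqrt (1 / 2 * r₁ ^ 2 * (T * r) ^ 2)) ^ 2 with hk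
  have hk0 : 0 < k := by positivity
  have h2 : q * ‖z₀‖ ^ 2 ≤ ∫ s in t..t + T, inner ℝ (z s) (A s (z s)) := by
    refine le_of_mul_le_mul_left ?_ hk0
    calc k * (q * ‖z₀‖ ^ 2) = q * k * ‖z₀‖ ^ 2 := by ring
      _ ≤ c * ‖z₀‖ ^ 2 := by gcongr
      _ ≤ _ := h1
  linarith

/-- The energy left after one window is nonnegative, so the loss cannot exceed the initial energy.
This keeps the contraction factor `1 - q / P` nonnegative. -/
theorem two_mul_le_P [Nontrivial E] (h : GradFlow Γ Q A p P r₁ r c T)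
    (hq : q * (1 + Real.sqrt (1 / 2 * r₁ ^ 2 * (T * r) ^ 2)) ^ 2 ≤ c) : 2 * q ≤ P := by
  obtain ⟨x, hx⟩ := exists_ne (0 : E)
  obtain ⟨z, hz⟩ := exists_isSolution_gradField (Γ := Γ) h.meas h.norm_A le_rfl x
    (u := fun _ => (0 : E)) measurable_const ⟨0, by rintro _ ⟨_, _, rfl⟩; simp⟩
  have h1 := h.unforced_window hq le_rfl hz
  have h2 := h.nonneg_Q (z (0 + T))
  have h3 : 2 * q * ‖x‖ ^ 2 ≤ P * ‖x‖ ^ 2 := by linarith [h.upper_Q x]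
  exact le_of_mul_le_mul_right h3 (by positivity)

/-- The energy is multiplied by at most `1 - 2 * q / P`, which is below `(1 - q / P) ^ 2`. -/
theorem wnorm_unforced_window [Nontrivial E] (h : GradFlow Γ Q A p P r₁ r c T) (hq0 : 0 ≤ q)
    (hq : q * (1 + Real.sqrt (1 / 2 * r₁ ^ 2 * (T * r) ^ 2)) ^ 2 ≤ c) {t : ℝ} (ht : 0 ≤ t)
    {z₀ : E} {z : ℝ → E} (hz : IsSolution (gradField Γ A) (fun _ => 0) t z₀ z) :
    wnorm Q (z (t + T)) ≤ (1 - q / P) * wnorm Q z₀ := by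
  have hP := h.P_pos
  have hqP := h.two_mul_le_P hq
  have h0 : 0 ≤ 1 - q / P := by
    rw [sub_nonneg, div_le_one hP]; linarith
  refine (Real.sqrt_le_left (mul_nonneg h0 (Real.sqrt_nonneg _))).2 ?_
  rw [mul_pow, Real.sq_sqrt (h.nonneg_Q z₀)]
  have h1 := h.unforced_window hq ht hz
  have h2 := h.upper_Q z₀
  have h3 := mul_le_mul_of_nonneg_left h2 (div_nonneg hq0 hP.le)
  have h4 : q / P * (P * ‖z₀‖ ^ 2) = q * ‖z₀‖ ^ 2 := by field_simp
  nlinarith [mul_nonneg (sq_nonneg (q / P)) (h.nonneg_Q z₀)]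

/-- Iterating the window contraction. -/
theorem wnorm_iterate [Nontrivial E] (h : GradFlow Γ Q A p P r₁ r c T) (hq0 : 0 < q)
    (hq : q * (1 + Real.sqrt (1 / 2 * r₁ ^ 2 * (T * r) ^ 2)) ^ 2 ≤ c) {t₀ : ℝ} (ht : 0 ≤ t₀)
    {u x : ℝ → E} (hu : Measurable u) {x₀ : E} (hx : IsSolution (gradField Γ A) u t₀ x₀ x)
    {s D : ℝ} (hs : 0 ≤ s) (hsT : s ≤ T) (k : ℕ)
    (hD : ∀ τ ∈ Set.Icc t₀ (t₀ + s + k * T), ‖u τ‖ ≤ D) :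
    wnorm Q (x (t₀ + s + k * T)) ≤
      (1 - q / P) ^ k * wnorm Q x₀ + Real.sqrt P * D * (T * P / q) := by
  have hP := h.P_pos
  have hT := h.T_pos
  have hqP := h.two_mul_le_P hq
  have hD0 : 0 ≤ D := (norm_nonneg _).trans (hD t₀ ⟨le_rfl, by
    have : 0 ≤ (k : ℝ) * T := by positivity
    linarith⟩)
  have h0 : 0 ≤ 1 - q / P := by
    rw [sub_nonneg, div_le_one hP]; linarith
  have hm : 0 ≤ Real.sqrt P * D := mul_nonneg (Real.sqrt_nonneg _) hD0
  induction k with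
  | zero =>
    obtain ⟨z, hz, hxz⟩ := h.exists_unforced ht hu hx
    simp only [Nat.cast_zero, zero_mul, add_zero, pow_zero, one_mul] at hD ⊢
    have h1 := hxz (t₀ + s) D (by linarith) hD
    have h2 : wnorm Q (z (t₀ + s)) ≤ wnorm Q x₀ :=
      Real.sqrt_le_sqrt (h.unforced_le (by linarith) hz)
    -- The incomplete window of length `s ≤ T` comes first; its contribution fits in the final bound
    -- because `q ≤ P`.
    have h3 : t₀ + s - t₀ ≤ T * P / q := by
      rw [le_div_iff₀ hq0]
      nlinarith
    nlinarith [mul_le_mul_of_nonneg_left h3 hm]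
  | succ k ih =>
    have hle : t₀ + s + k * T ≤ t₀ + s + (k + 1 : ℕ) * T := by push_cast; nlinarith
    have ih' := ih fun τ hτ => hD τ ⟨hτ.1, hτ.2.trans hle⟩
    have ht₁ : t₀ ≤ t₀ + s + k * T := by have : 0 ≤ (k : ℝ) * T := by positivity
                                         linarith
    set t₁ := t₀ + s + k * T with ht₁_def
    have heq : t₀ + s + (k + 1 : ℕ) * T = t₁ + T := by rw [ht₁_def]; push_cast; ring
    rw [heq] at hD ⊢
    obtain ⟨z, hz, hxz⟩ := h.exists_unforced (ht.trans ht₁) hu (hx.restart ht₁)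
    have h1 := hxz (t₁ + T) D (by linarith) fun τ hτ => hD τ ⟨ht₁.trans hτ.1, hτ.2⟩
    have h2 := h.wnorm_unforced_window hq0.le hq (ht.trans ht₁) hz
    have h3 := mul_le_mul_of_nonneg_left ih' h0
    -- `√P * D * (T * P / q)` is the fixed point of the one-window recursion, that is, the sum of
    -- the geometric series.
    have h4 : (1 - q / P) * (Real.sqrt P * D * (T * P / q)) + Real.sqrt P * D * T =
        Real.sqrt P * D * (T * P / q) := by field_simp; ring
    have h5 : (1 - q / P) ^ (k + 1) = (1 - q / P) * (1 - q / P) ^ k := pow_succ' _ _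
    have h6 : t₁ + T - t₁ = T := by ring
    rw [h6] at h1
    rw [h5]
    linarith

/-- The system `x' = -Γ A(t) x + u` is input-to-state stable with an explicit gain. -/
theorem isISSGain [Nontrivial E] (h : GradFlow Γ Q A p P r₁ r c T) (hq0 : 0 < q)
    (hq : q * (1 + Real.sqrt (1 / 2 * r₁ ^ 2 * (T * r) ^ 2)) ^ 2 ≤ c) {g : ℝ}
    (hg : T * P / q * Real.sqrt (P / p) ≤ g) : IsISSGain (gradField Γ A) g := by
  have hP := h.P_pos
  have hT := h.T_pos
  have hp := h.p_pos
  have hqP := h.two_mul_le_P hq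
  have hM : 0 < Real.sqrt (P / p) := Real.sqrt_pos.2 (by positivity)
  have hMp : Real.sqrt (P / p) * Real.sqrt p = Real.sqrt P := by
    rw [← Real.sqrt_mul (by positivity)]; congr 1; field_simp
  have hsp : 0 < Real.sqrt p := Real.sqrt_pos.2 hp
  refine ⟨lt_of_lt_of_le (by positivity) hg,
    -- The factor `√(P / p)` converts between the Euclidean and the weighted norm; the `- 1` in the
    -- exponent pays for the incomplete window, as `k > (t - t₀) / T - 1`.
    fun y s => Real.sqrt (P / p) * Real.exp (-(q / P) * (s / T - 1)) * y, ⟨?_, ?_⟩, ?_⟩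
  · intro s _
    refine ⟨by fun_prop, ?_, by simp⟩
    intro y _ y' _ hyy
    have : 0 < Real.sqrt (P / p) * Real.exp (-(q / P) * (s / T - 1)) := by positivity
    exact mul_lt_mul_of_pos_left hyy this
  · intro y hy
    refine ⟨?_, ?_⟩
    · intro s _ s' _ hss
      have h1 : -(q / P) * (s' / T - 1) ≤ -(q / P) * (s / T - 1) := by
        have : s / T ≤ s' / T := by gcongr
        have h2 : 0 < q / P := by positivity
        nlinarith
      show Real.sqrt (P / p) * Real.exp (-(q / P) * (s' / T - 1)) * y ≤
        Real.sqrt (P / p) * Real.exp (-(q / P) * (s / T - 1)) * y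
      gcongr
    · have h1 : Filter.Tendsto (fun s : ℝ => s / T - 1) Filter.atTop Filter.atTop :=
        Filter.tendsto_atTop_add_const_right _ _ (Filter.tendsto_id.atTop_div_const hT)
      have h2 : Filter.Tendsto (fun s : ℝ => -(q / P) * (s / T - 1)) Filter.atTop Filter.atBot :=
        Filter.Tendsto.const_mul_atTop_of_neg (by have : 0 < q / P := by positivity
                                                  linarith) h1
      have h3 := ((Real.tendsto_exp_atBot.comp h2).const_mul (Real.sqrt (P / p))).mul_const y
      simpa using h3
  · intro t₀ x₀ u ht₀ hu hub
    refine ⟨exists_isSolution_gradField h.meas h.norm_A ht₀ x₀ hu hub, fun x hx t ht => ?_⟩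
    have hDb : BddAbove ((fun τ => ‖u τ‖) '' Set.Icc t₀ t) :=
      hub.mono (Set.image_mono Set.Icc_subset_Ici_self)
    set D := sSup ((fun τ => ‖u τ‖) '' Set.Icc t₀ t) with hDdef
    have hD : ∀ τ ∈ Set.Icc t₀ t, ‖u τ‖ ≤ D := fun τ hτ => le_csSup hDb ⟨τ, hτ, rfl⟩
    have hD0 : 0 ≤ D := (norm_nonneg _).trans (hD t₀ ⟨le_rfl, ht⟩)
    have hτ0 : 0 ≤ (t - t₀) / T := div_nonneg (by linarith) hT.le
    set k := ⌊(t - t₀) / T⌋₊ with hk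
    have hk1 : (k : ℝ) ≤ (t - t₀) / T := Nat.floor_le hτ0
    have hk2 : (t - t₀) / T < k + 1 := Nat.lt_floor_add_one _
    have hk1' : k * T ≤ t - t₀ := (le_div_iff₀ hT).1 hk1
    have hk2' : t - t₀ < (k + 1) * T := (div_lt_iff₀ hT).1 hk2
    have heq : t₀ + (t - t₀ - k * T) + k * T = t := by ring
    have h1 := h.wnorm_iterate hq0 hq ht₀ hu hx (s := t - t₀ - k * T) (D := D) (by linarith)
      (by linarith) k (by rw [heq]; exact hD)
    rw [heq] at h1
    have h0 : 0 ≤ 1 - q / P := by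
      rw [sub_nonneg, div_le_one hP]; linarith
    have h2 : (1 - q / P) ^ k ≤ Real.exp (-(q / P) * ((t - t₀) / T - 1)) := by
      have h3 : 1 - q / P ≤ Real.exp (-(q / P)) := by
        have := Real.add_one_le_exp (-(q / P)); linarith
      refine (pow_le_pow_left₀ h0 h3 k).trans ?_
      rw [← Real.exp_nat_mul]
      apply Real.exp_le_exp.2
      have h4 : 0 < q / P := by positivity
      nlinarith
    have h3 : wnorm Q x₀ ≤ Real.sqrt P * ‖x t₀‖ := by rw [hx.initial]; exact h.wnorm_le x₀
    have h4 := h.le_wnorm (x t)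
    refine le_of_mul_le_mul_left ?_ hsp
    calc Real.sqrt p * ‖x t‖ ≤ wnorm Q (x t) := h4
      _ ≤ (1 - q / P) ^ k * wnorm Q x₀ + Real.sqrt P * D * (T * P / q) := h1
      _ ≤ Real.exp (-(q / P) * ((t - t₀) / T - 1)) * (Real.sqrt P * ‖x t₀‖) +
          Real.sqrt P * D * (T * P / q) := by
        have : 0 ≤ wnorm Q x₀ := Real.sqrt_nonneg _
        gcongr
      _ = Real.sqrt p * (Real.sqrt (P / p) * Real.exp (-(q / P) * ((t - t₀) / T - 1)) * ‖x t₀‖ +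
          T * P / q * Real.sqrt (P / p) * D) := by rw [← hMp]; ring
      _ ≤ Real.sqrt p * (Real.sqrt (P / p) * Real.exp (-(q / P) * ((t - t₀) / T - 1)) * ‖x t₀‖ +
          g * D) := by gcongr

end GradFlow

end Gain

/-! ### Matrices as operators: measurability, integrals and extreme eigenvalues. -/

section Matrices

variable {ι : Type*} [Fintype ι] [DecidableEq ι]

theorem inner_toEuclideanCLM_symm {A : Matrix ι ι ℝ} (hA : Aᵀ = A) (x y : EuclideanSpace ℝ ι) :
    inner ℝ (Matrix.toEuclideanCLM (n := ι) (𝕜 := ℝ) A x) y =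
      inner ℝ x (Matrix.toEuclideanCLM (n := ι) (𝕜 := ℝ) A y) := by
  rw [real_inner_comm, Matrix.inner_toEuclideanCLM, Matrix.inner_toEuclideanCLM,
    Matrix.dotProduct_mulVec, ← Matrix.mulVec_transpose, hA, dotProduct_comm]

theorem inner_toEuclideanCLM_nonneg {A : Matrix ι ι ℝ} (hA : A.PosSemidef) (x : EuclideanSpace ℝ ι) :
    0 ≤ inner ℝ x (Matrix.toEuclideanCLM (n := ι) (𝕜 := ℝ) A x) := by
  rw [Matrix.inner_toEuclideanCLM]
  simpa using hA.dotProduct_mulVec_nonneg x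

/-- The operator is a finite combination of fixed matrix units with measurable coefficients. -/
theorem stronglyMeasurable_toEuclideanCLM {A : ℝ → Matrix ι ι ℝ}
    (hA : ∀ i j, Measurable fun t => A t i j) :
    StronglyMeasurable fun t => Matrix.toEuclideanCLM (n := ι) (𝕜 := ℝ) (A t) := by
  have h : (fun t => Matrix.toEuclideanCLM (n := ι) (𝕜 := ℝ) (A t)) = fun t =>
      ∑ i, ∑ j, A t i j • Matrix.toEuclideanCLM (n := ι) (𝕜 := ℝ) (Matrix.single i j 1) := by
    ext1 t
    conv_lhs => rw [Matrix.matrix_eq_sum_single (A t)]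
    simp only [map_sum, ← map_smul, Matrix.smul_single, smul_eq_mul, mul_one]
  rw [h]
  exact Finset.stronglyMeasurable_fun_sum _ fun i _ => Finset.stronglyMeasurable_fun_sum _ fun j _ =>
    (hA i j).stronglyMeasurable.smul_const _

theorem abs_apply_le_specNorm (A : Matrix ι ι ℝ) (i j : ι) : |A i j| ≤ specNorm A := by
  have h : A i j = inner ℝ (EuclideanSpace.single i (1 : ℝ))
      (Matrix.toEuclideanCLM (n := ι) (𝕜 := ℝ) A (EuclideanSpace.single j (1 : ℝ))) := by
    rw [Matrix.inner_toEuclideanCLM]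
    simp
  rw [h, ← Real.norm_eq_abs]
  refine (norm_inner_le_norm _ _).trans ?_
  have := (Matrix.toEuclideanCLM (n := ι) (𝕜 := ℝ) A).le_opNorm (EuclideanSpace.single j (1 : ℝ))
  simpa [specNorm] using this

theorem intervalIntegrable_apply {A : ℝ → Matrix ι ι ℝ} (hA : ∀ i j, Measurable fun t => A t i j)
    {r : ℝ} (hr : ∀ t, 0 ≤ t → specNorm (A t) ≤ r) {a b : ℝ} (ha : 0 ≤ a) (hab : a ≤ b) (i j : ι) :
    IntervalIntegrable (fun t => A t i j) volume a b :=
  intervalIntegrable_of_norm_le (hA i j) hab fun t ht =>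
    (abs_apply_le_specNorm (A t) i j).trans (hr t (ha.trans ht.1))

theorem intervalIntegrable_finsetSum {κ : Type*} (s : Finset κ) {f : κ → ℝ → ℝ} {a b : ℝ}
    (hf : ∀ i ∈ s, IntervalIntegrable (f i) volume a b) :
    IntervalIntegrable (fun t => ∑ i ∈ s, f i t) volume a b := by
  simpa only [Finset.sum_fn] using IntervalIntegrable.sum s hf

theorem intervalIntegrable_inner {A : ℝ → Matrix ι ι ℝ} {a b : ℝ}
    (hA : ∀ i j, IntervalIntegrable (fun t => A t i j) volume a b) (x : EuclideanSpace ℝ ι) :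
    IntervalIntegrable (fun s => inner ℝ x (Matrix.toEuclideanCLM (n := ι) (𝕜 := ℝ) (A s) x))
      volume a b := by
  simp only [Matrix.inner_toEuclideanCLM, dotProduct, Matrix.mulVec]
  refine intervalIntegrable_finsetSum _ fun i _ => IntervalIntegrable.const_mul ?_ _
  exact intervalIntegrable_finsetSum _ fun j _ => (hA i j).mul_const _

theorem integral_inner_eq {A : ℝ → Matrix ι ι ℝ} {a b : ℝ}
    (hA : ∀ i j, IntervalIntegrable (fun t => A t i j) volume a b) (x : EuclideanSpace ℝ ι) :
    ∫ s in a..b, inner ℝ x (Matrix.toEuclideanCLM (n := ι) (𝕜 := ℝ) (A s) x) =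
      inner ℝ x (Matrix.toEuclideanCLM (n := ι) (𝕜 := ℝ) (matIntegral A a b) x) := by
  simp only [Matrix.inner_toEuclideanCLM, dotProduct, Matrix.mulVec]
  rw [intervalIntegral.integral_finsetSum]
  · refine Finset.sum_congr rfl fun i _ => ?_
    rw [intervalIntegral.integral_const_mul, intervalIntegral.integral_finsetSum]
    · simp [matIntegral]
    · exact fun j _ => (hA i j).mul_const _
  · intro i _
    exact (intervalIntegrable_finsetSum _ fun j _ => (hA i j).mul_const _).const_mul _

/-- The quadratic form of a symmetric matrix in an orthonormal eigenbasis. -/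
theorem inner_eq_sum_eigenvalues {A : Matrix ι ι ℝ} (hA : A.IsHermitian) (x : EuclideanSpace ℝ ι) :
    inner ℝ x (Matrix.toEuclideanCLM (n := ι) (𝕜 := ℝ) A x) =
      ∑ k, hA.eigenvalues k * inner ℝ (hA.eigenvectorBasis k) x ^ 2 := by
  rw [← hA.eigenvectorBasis.sum_inner_mul_inner]
  refine Finset.sum_congr rfl fun k _ => ?_
  have h1 : Matrix.toEuclideanCLM (n := ι) (𝕜 := ℝ) A (hA.eigenvectorBasis k) =
      hA.eigenvalues k • hA.eigenvectorBasis k := by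
    apply (WithLp.ofLp_injective 2)
    exact hA.mulVec_eigenvectorBasis k
  have hT : Aᵀ = A := (Matrix.conjTranspose_eq_transpose_of_trivial A) ▸ hA.eq
  rw [← inner_toEuclideanCLM_symm hT, h1, real_inner_smul_left, real_inner_comm x]
  ring

theorem sum_sq_inner_eigenvectorBasis {A : Matrix ι ι ℝ} (hA : A.IsHermitian)
    (x : EuclideanSpace ℝ ι) : ∑ k, inner ℝ (hA.eigenvectorBasis k) x ^ 2 = ‖x‖ ^ 2 := by
  rw [← hA.eigenvectorBasis.sum_sq_norm_inner_right x]
  simp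

theorem inner_le_lambdaMax {A : Matrix ι ι ℝ} (hA : A.IsHermitian) (x : EuclideanSpace ℝ ι) :
    inner ℝ x (Matrix.toEuclideanCLM (n := ι) (𝕜 := ℝ) A x) ≤ lambdaMax A * ‖x‖ ^ 2 := by
  rw [inner_eq_sum_eigenvalues hA, ← sum_sq_inner_eigenvectorBasis hA, Finset.mul_sum]
  refine Finset.sum_le_sum fun k _ => mul_le_mul_of_nonneg_right ?_ (sq_nonneg _)
  exact le_csSup (Matrix.finite_real_spectrum (𝕜 := ℝ)).bddAbove (hA.eigenvalues_mem_spectrum_real k)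

theorem lambdaMin_le_inner {A : Matrix ι ι ℝ} (hA : A.IsHermitian) (x : EuclideanSpace ℝ ι) :
    lambdaMin A * ‖x‖ ^ 2 ≤ inner ℝ x (Matrix.toEuclideanCLM (n := ι) (𝕜 := ℝ) A x) := by
  rw [inner_eq_sum_eigenvalues hA, ← sum_sq_inner_eigenvectorBasis hA, Finset.mul_sum]
  refine Finset.sum_le_sum fun k _ => mul_le_mul_of_nonneg_right ?_ (sq_nonneg _)
  exact csInf_le (Matrix.finite_real_spectrum (𝕜 := ℝ)).bddBelow (hA.eigenvalues_mem_spectrum_real k)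

theorem lambdaMin_pos [Nonempty ι] {A : Matrix ι ι ℝ} (hA : A.PosDef) : 0 < lambdaMin A := by
  have hne : (spectrum ℝ A).Nonempty :=
    ⟨_, hA.1.eigenvalues_mem_spectrum_real (Classical.arbitrary ι)⟩
  have h := hne.csInf_mem (Matrix.finite_real_spectrum (𝕜 := ℝ))
  rw [hA.1.spectrum_real_eq_range_eigenvalues] at h
  obtain ⟨k, hk⟩ := h
  rw [lambdaMin, hA.1.spectrum_real_eq_range_eigenvalues, ← hk]
  exact hA.eigenvalues_pos k

end Matrices

/-! ### Stacked vectors: rows diagonalise block matrices, columns diagonalise `L ⊗ I`. -/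

section Slices

variable {n N : ℕ}

/-- The `i`-th block of a stacked vector. -/
def blockRow (x : EuclideanSpace ℝ (Fin n × Fin N)) (i : Fin n) : EuclideanSpace ℝ (Fin N) :=
  WithLp.toLp 2 fun k => x (i, k)

/-- The vector of the `k`-th entries of all blocks. -/
def blockCol (x : EuclideanSpace ℝ (Fin n × Fin N)) (k : Fin N) : EuclideanSpace ℝ (Fin n) :=
  WithLp.toLp 2 fun i => x (i, k)

theorem sq_norm_eq_sum_blockRow (x : EuclideanSpace ℝ (Fin n × Fin N)) :
    ‖x‖ ^ 2 = ∑ i, ‖blockRow x i‖ ^ 2 := by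
  simp only [EuclideanSpace.real_norm_sq_eq, Fintype.sum_prod_type, blockRow]

theorem sq_norm_eq_sum_blockCol (x : EuclideanSpace ℝ (Fin n × Fin N)) :
    ‖x‖ ^ 2 = ∑ k, ‖blockCol x k‖ ^ 2 := by
  simp only [EuclideanSpace.real_norm_sq_eq, Fintype.sum_prod_type, blockCol]
  rw [Finset.sum_comm]

theorem diagBlocks_apply {p q : ℕ} (B : Fin n → Matrix (Fin p) (Fin q) ℝ) (i j : Fin n) (k : Fin p)
    (l : Fin q) : diagBlocks B (i, k) (j, l) = if i = j then B i k l else 0 := by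
  simp [diagBlocks, Matrix.blockDiagonal_apply]

theorem blockRow_diagBlocks (B : Fin n → Matrix (Fin N) (Fin N) ℝ)
    (x : EuclideanSpace ℝ (Fin n × Fin N)) (i : Fin n) :
    blockRow (Matrix.toEuclideanCLM (n := Fin n × Fin N) (𝕜 := ℝ) (diagBlocks B) x) i =
      Matrix.toEuclideanCLM (n := Fin N) (𝕜 := ℝ) (B i) (blockRow x i) := by
  ext k
  simp [blockRow, Matrix.mulVec, dotProduct, Fintype.sum_prod_type, diagBlocks_apply]

theorem blockCol_kronecker (L : Matrix (Fin n) (Fin n) ℝ)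
    (x : EuclideanSpace ℝ (Fin n × Fin N)) (k : Fin N) :
    blockCol (Matrix.toEuclideanCLM (n := Fin n × Fin N) (𝕜 := ℝ) (L ⊗ₖ (1 : Matrix (Fin N) (Fin N) ℝ)) x) k =
      Matrix.toEuclideanCLM (n := Fin n) (𝕜 := ℝ) L (blockCol x k) := by
  ext i
  simp [blockCol, Matrix.mulVec, dotProduct, Fintype.sum_prod_type, Matrix.one_apply]

theorem inner_eq_sum_blockRow (x y : EuclideanSpace ℝ (Fin n × Fin N)) :
    inner ℝ x y = ∑ i, inner ℝ (blockRow x i) (blockRow y i) := by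
  simp only [PiLp.inner_apply, Fintype.sum_prod_type, blockRow]

theorem inner_eq_sum_blockCol (x y : EuclideanSpace ℝ (Fin n × Fin N)) :
    inner ℝ x y = ∑ k, inner ℝ (blockCol x k) (blockCol y k) := by
  simp only [PiLp.inner_apply, Fintype.sum_prod_type, blockCol]
  rw [Finset.sum_comm]

theorem specNorm_diagBlocks_le {B : Fin n → Matrix (Fin N) (Fin N) ℝ} {r : ℝ} (hr : 0 ≤ r)
    (hB : ∀ i, specNorm (B i) ≤ r) : specNorm (diagBlocks B) ≤ r := by
  refine ContinuousLinearMap.opNorm_le_bound _ hr fun x => ?_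
  refine le_of_sq_le_sq ?_ (by positivity)
  rw [mul_pow, sq_norm_eq_sum_blockRow, sq_norm_eq_sum_blockRow x, Finset.mul_sum]
  refine Finset.sum_le_sum fun i _ => ?_
  rw [blockRow_diagBlocks, ← mul_pow]
  gcongr
  exact ContinuousLinearMap.le_of_opNorm_le _ (hB i) _

theorem specNorm_kronecker_le {L : Matrix (Fin n) (Fin n) ℝ} {r : ℝ} (hr : 0 ≤ r)
    (hL : specNorm L ≤ r) : specNorm (L ⊗ₖ (1 : Matrix (Fin N) (Fin N) ℝ)) ≤ r := by
  refine ContinuousLinearMap.opNorm_le_bound _ hr fun x => ?_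
  refine le_of_sq_le_sq ?_ (by positivity)
  rw [mul_pow, sq_norm_eq_sum_blockCol, sq_norm_eq_sum_blockCol x, Finset.mul_sum]
  refine Finset.sum_le_sum fun i _ => ?_
  rw [blockCol_kronecker, ← mul_pow]
  gcongr
  exact ContinuousLinearMap.le_of_opNorm_le _ hL _

theorem posDef_diagBlocks {B : Fin n → Matrix (Fin N) (Fin N) ℝ} (hB : ∀ i, (B i).PosDef) :
    (diagBlocks B).PosDef := by
  refine Matrix.PosDef.of_dotProduct_mulVec_pos ?_ fun x hx => ?_
  · ext ⟨i, k⟩ ⟨j, l⟩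
    simp only [Matrix.conjTranspose_apply, diagBlocks_apply, star_trivial]
    by_cases h : i = j
    · subst h
      simpa using (hB i).1.apply k l
    · simp [h, Ne.symm h]
  · set y : EuclideanSpace ℝ (Fin n × Fin N) := WithLp.toLp 2 x with hy
    have h1 : star x ⬝ᵥ (diagBlocks B *ᵥ x) =
        inner ℝ y (Matrix.toEuclideanCLM (n := Fin n × Fin N) (𝕜 := ℝ) (diagBlocks B) y) := by
      rw [Matrix.inner_toEuclideanCLM]; simp [hy]
    rw [h1, inner_eq_sum_blockRow]
    simp only [blockRow_diagBlocks]
    obtain ⟨⟨i, k⟩, hik⟩ := Function.ne_iff.1 hx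
    refine Finset.sum_pos' (fun j _ => inner_toEuclideanCLM_nonneg (hB j).posSemidef _)
      ⟨i, Finset.mem_univ _, ?_⟩
    rw [Matrix.inner_toEuclideanCLM]
    have h2 : (blockRow y i).ofLp ≠ 0 := Function.ne_iff.2 ⟨k, hik⟩
    simpa using (hB i).dotProduct_mulVec_pos h2

theorem transpose_diagBlocks_mul {p q : ℕ} (B : Fin n → Matrix (Fin p) (Fin q) ℝ) :
    (diagBlocks B)ᵀ * diagBlocks B = diagBlocks fun i => (B i)ᵀ * B i := by
  ext ⟨i, k⟩ ⟨j, l⟩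
  rw [Matrix.mul_apply, Fintype.sum_prod_type]
  simp only [Matrix.transpose_apply, diagBlocks_apply, Matrix.mul_apply, mul_ite, ite_mul, zero_mul,
    mul_zero]
  by_cases h : i = j
  · subst h
    simp
  · rw [if_neg h]
    refine Finset.sum_eq_zero fun a _ => Finset.sum_eq_zero fun b _ => ?_
    by_cases ha : a = i
    · rw [if_neg (by rw [ha]; exact h)]
    · rw [if_neg ha]
      simp

end Slices

/-! ### Graph Laplacians and their independence of the orientation. -/

section Laplacians

variable {n : ℕ} {G : SimpleGraph (Fin n)}

theorem EdgeOrientation.source_ne_sink (o : EdgeOrientation G) (e : G.edgeSet) :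
    o.source e ≠ o.sink e := by
  have h : s(o.source e, o.sink e) ∈ G.edgeSet := by rw [o.ends_eq]; exact e.2
  exact (SimpleGraph.mem_edgeSet G |>.1 h).ne

/-- Reversing an edge negates its column, which leaves products of two entries of that column
unchanged. -/
theorem incidence_mul_incidence (o o' : EdgeOrientation G) (e : G.edgeSet) (i j : Fin n) :
    incidence o i e * incidence o j e = incidence o' i e * incidence o' j e := by
  have h := (o.ends_eq e).trans (o'.ends_eq e).symm
  have hne := o'.source_ne_sink e
  simp only [incidence, Matrix.of_apply]
  rcases Sym2.eq_iff.1 h with ⟨h1, h2⟩ | ⟨h1, h2⟩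
  · rw [h1, h2]
  · rw [h1, h2]
    split_ifs <;> simp_all

theorem laplacian_eq (o o' : EdgeOrientation G) : laplacian o = laplacian o' := by
  ext i j
  simp only [laplacian, Matrix.mul_apply, Matrix.transpose_apply]
  exact Finset.sum_congr rfl fun e _ => incidence_mul_incidence o o' e i j

theorem transpose_laplacian (o : EdgeOrientation G) : (laplacian o)ᵀ = laplacian o := by
  simp [laplacian]

theorem posSemidef_laplacian (o : EdgeOrientation G) : (laplacian o).PosSemidef := by
  classical
  rw [laplacian, ← Matrix.conjTranspose_eq_transpose_of_trivial]
  exact Matrix.posSemidef_self_mul_conjTranspose _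

theorem sum_incidence (o : EdgeOrientation G) (e : G.edgeSet) : ∑ i, incidence o i e = 0 := by
  have hne := o.source_ne_sink e
  have h : ∀ i, incidence o i e =
      (if i = o.source e then 1 else 0) - (if i = o.sink e then 1 else 0) := by
    intro i
    simp only [incidence, Matrix.of_apply]
    split_ifs <;> simp_all
  simp [h]

theorem sum_laplacian (o : EdgeOrientation G) (i : Fin n) : ∑ j, laplacian o i j = 0 := by
  simp only [laplacian, Matrix.mul_apply, Matrix.transpose_apply]
  rw [Finset.sum_comm]
  simp [← Finset.mul_sum, sum_incidence]

/-- The Laplacian of a measurable time-varying graph is measurable, whatever the orientations. -/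
theorem measurable_laplacian {graph : ℝ → SimpleGraph (Fin n)}
    (h : ∀ i j, MeasurableSet {t | (graph t).Adj i j}) (o : ∀ t, EdgeOrientation (graph t))
    (i j : Fin n) : Measurable fun t => laplacian (o t) i j := by
  classical
  -- The orientations may vary non-measurably in time, but the Laplacian factors through the graph
  -- alone, using one chosen orientation per graph.
  let F : SimpleGraph (Fin n) → ℝ := fun G =>
    if hG : Nonempty (EdgeOrientation G) then laplacian hG.some i j else 0
  have hF : (fun t => laplacian (o t) i j) = F ∘ graph := by
    ext t
    have hG : Nonempty (EdgeOrientation (graph t)) := ⟨o t⟩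
    simp only [F, Function.comp, dif_pos hG]
    rw [laplacian_eq (o t) hG.some]
  rw [hF]
  -- There are finitely many graphs, so it suffices that each level set of `graph` is measurable.
  let _ : MeasurableSpace (SimpleGraph (Fin n)) := ⊤
  refine measurable_from_top.comp (measurable_to_countable' fun G => ?_)
  have hset : graph ⁻¹' {G} = ⋂ i, ⋂ j, {t | (graph t).Adj i j ↔ G.Adj i j} := by
    ext t
    simp [SimpleGraph.ext_iff, funext_iff]
  rw [hset]
  refine MeasurableSet.iInter fun i => MeasurableSet.iInter fun j => ?_
  by_cases hij : G.Adj i j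
  · simp only [hij, iff_true]
    exact h i j
  · simp only [hij, iff_false]
    exact (h i j).compl

end Laplacians

/-! ### Spectral gap on the complement of the constant vectors. -/

section Consensus

variable {n : ℕ}

/-- The spectral gap of a symmetric matrix whose kernel is spanned by the constant vectors. -/
theorem spectral_gap {H : Matrix (Fin n) (Fin n) ℝ} (hn : 0 < n) (hH : Hᵀ = H)
    (hH1 : ∀ i, ∑ j, H i j = 0)
    (hker : Module.finrank ℝ (Module.End.eigenspace (Matrix.toLin' H) 0) = 1) {lam : ℝ}
    (hlam : ∀ μ ∈ spectrum ℝ H, μ ≠ 0 → lam ≤ μ) (c : EuclideanSpace ℝ (Fin n)) :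
    lam * (‖c‖ ^ 2 - (∑ i, c i) ^ 2 / n) ≤
      inner ℝ c (Matrix.toEuclideanCLM (n := Fin n) (𝕜 := ℝ) H c) := by
  have hHh : H.IsHermitian := by
    rw [Matrix.IsHermitian, Matrix.conjTranspose_eq_transpose_of_trivial, hH]
  have hn' : (n : ℝ) ≠ 0 := by positivity
  set o : EuclideanSpace ℝ (Fin n) := WithLp.toLp 2 fun _ => 1 with ho
  set m : ℝ := (∑ i, c i) / n with hm
  set y : EuclideanSpace ℝ (Fin n) := c - m • o with hy
  have hHo : Matrix.toEuclideanCLM (n := Fin n) (𝕜 := ℝ) H o = 0 := by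
    ext i
    simp [ho, Matrix.mulVec, dotProduct, hH1]
  have hoc : inner ℝ o c = ∑ i, c i := by simp [ho, PiLp.inner_apply]
  have hoo : inner ℝ o o = (n : ℝ) := by
    rw [real_inner_self_eq_norm_sq, EuclideanSpace.real_norm_sq_eq]; simp [ho]
  have hoy : inner ℝ o y = 0 := by
    rw [hy, inner_sub_right, real_inner_smul_right, hoc, hoo, hm]; field_simp; ring
  have hynorm : ‖y‖ ^ 2 = ‖c‖ ^ 2 - (∑ i, c i) ^ 2 / n := by
    rw [← real_inner_self_eq_norm_sq, hy, inner_sub_left, inner_sub_right, inner_sub_right,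
      real_inner_smul_left, real_inner_smul_left, real_inner_smul_right, real_inner_smul_right,
      real_inner_comm o c, hoc, hoo, real_inner_self_eq_norm_sq, hm]
    field_simp
    ring
  have hcy : inner ℝ c (Matrix.toEuclideanCLM (n := Fin n) (𝕜 := ℝ) H c) =
      inner ℝ y (Matrix.toEuclideanCLM (n := Fin n) (𝕜 := ℝ) H y) := by
    have hc : c = y + m • o := by rw [hy]; abel
    have hoH : ∀ z, inner ℝ o (Matrix.toEuclideanCLM (n := Fin n) (𝕜 := ℝ) H z) = 0 := by
      intro z
      rw [← inner_toEuclideanCLM_symm hH, hHo, inner_zero_left]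
    rw [hc, map_add, map_smul, hHo, smul_zero, add_zero, inner_add_left, real_inner_smul_left, hoH]
    simp
  rw [hcy, ← hynorm, inner_eq_sum_eigenvalues hHh, ← sum_sq_inner_eigenvectorBasis hHh,
    Finset.mul_sum]
  refine Finset.sum_le_sum fun k _ => ?_
  by_cases hk : hHh.eigenvalues k = 0
  · have hmem : ((hHh.eigenvectorBasis k).ofLp) ∈ Module.End.eigenspace (Matrix.toLin' H) 0 := by
      rw [Module.End.mem_eigenspace_iff, Matrix.toLin'_apply, hHh.mulVec_eigenvectorBasis, hk]
    have homem : o.ofLp ∈ Module.End.eigenspace (Matrix.toLin' H) 0 := by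
      rw [Module.End.mem_eigenspace_iff, Matrix.toLin'_apply, zero_smul]
      exact congrArg WithLp.ofLp hHo
    have hone : (⟨o.ofLp, homem⟩ : Module.End.eigenspace (Matrix.toLin' H) 0) ≠ 0 := by
      intro h
      have h2 := congrFun (congrArg Subtype.val h) ⟨0, hn⟩
      simp [ho] at h2
    obtain ⟨a, ha⟩ := (finrank_eq_one_iff_of_nonzero' _ hone).1 hker ⟨_, hmem⟩
    have hv : hHh.eigenvectorBasis k = a • o := by
      apply WithLp.ofLp_injective 2
      exact (congrArg Subtype.val ha).symm
    rw [hv, real_inner_smul_left, hoy]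
    simp
  · exact mul_le_mul_of_nonneg_right (hlam _ (hHh.eigenvalues_mem_spectrum_real k) hk) (sq_nonneg _)

end Consensus

/-! ### Positivity and comparison of the constants. -/

section Constants

variable {n N : ℕ} {T α ι₁ lam r₂ : ℝ}

theorem isCompact_iota2Lo_image :
    IsCompact ((fun a : EuclideanSpace ℝ (Fin N) =>
      max (α * lam * (1 - ‖a‖ ^ 2))
        (ι₁ / n * ‖a‖ ^ 2 - 2 * r₂ * T * Real.sqrt (‖a‖ ^ 2 * (1 - ‖a‖ ^ 2)))) ''
      {a | ‖a‖ ^ 2 ≤ 1}) := by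
  have hset : {a : EuclideanSpace ℝ (Fin N) | ‖a‖ ^ 2 ≤ 1} = Metric.closedBall 0 1 := by
    ext a
    simp
  rw [hset]
  exact (isCompact_closedBall _ _).image (by fun_prop)

theorem iota2Lo_le (a : EuclideanSpace ℝ (Fin N)) (ha : ‖a‖ ^ 2 ≤ 1) :
    iota2Lo n N T α ι₁ lam r₂ ≤ max (α * lam * (1 - ‖a‖ ^ 2))
      (ι₁ / n * ‖a‖ ^ 2 - 2 * r₂ * T * Real.sqrt (‖a‖ ^ 2 * (1 - ‖a‖ ^ 2))) :=
  csInf_le isCompact_iota2Lo_image.bddBelow ⟨a, ha, rfl⟩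

/-- The infimum is attained by compactness. At the minimiser the consensus term is positive inside
the ball, and on the sphere the cross term vanishes and leaves `ι₁ / n`. -/
theorem iota2Lo_pos (hn : 0 < n) (hα : 0 < α) (hι₁ : 0 < ι₁) (hlam : 0 < lam) :
    0 < iota2Lo n N T α ι₁ lam r₂ := by
  obtain ⟨a, ha, h⟩ := (isCompact_iota2Lo_image (n := n) (N := N) (T := T) (α := α) (ι₁ := ι₁)
    (lam := lam) (r₂ := r₂)).sInf_mem ⟨_, 0, by simp, rfl⟩
  rw [iota2Lo, ← h]
  have ha' : ‖a‖ ^ 2 ≤ 1 := ha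
  rcases ha'.lt_or_eq with h1 | h1
  · exact lt_max_of_lt_left (mul_pos (mul_pos hα hlam) (by linarith))
  · refine lt_max_of_lt_right ?_
    rw [h1]
    simp
    positivity

/-- The closed-loop lower bound `ι̲₃` is at most `c / (1 + √φ₁)²`. -/
theorem iota3Lo_mul_le {r₁ b c : ℝ} (hc : 0 < c) (hcb : c ≤ b) :
    iota3Lo r₁ b c * (1 + Real.sqrt (1 / 2 * r₁ ^ 2 * b ^ 2)) ^ 2 ≤ c := by
  set φ := phi1 r₁ b with hφ
  have hφ' : 1 / 2 * r₁ ^ 2 * b ^ 2 = φ := rfl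
  have hb : 0 < b := hc.trans_le hcb
  have hφ0 : 0 ≤ φ := by rw [← hφ']; positivity
  have harg : 0 ≤ b - c + φ * c := by nlinarith [mul_nonneg hφ0 hc.le]
  -- Rationalising the difference of roots gives the single form `(c / S) ^ 2` for both branches of
  -- `iota3Lo`.
  set S := Real.sqrt (b - c + φ * c) + Real.sqrt b with hS
  have hSpos : 0 < S := add_pos_of_nonneg_of_pos (Real.sqrt_nonneg _) (Real.sqrt_pos.2 hb)
  have heq : iota3Lo r₁ b c = (c / S) ^ 2 := by
    rw [iota3Lo]
    split_ifs with h
    · have : S = 2 * Real.sqrt b := by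
        rw [hS, hφ, h]; ring_nf
      rw [this, div_pow, mul_pow, Real.sq_sqrt hb.le]
      norm_num
    · have h1 : φ - 1 ≠ 0 := sub_ne_zero.2 h
      have h2 : (Real.sqrt (b - c + φ * c) - Real.sqrt b) * S = (φ - 1) * c := by
        have e1 := Real.mul_self_sqrt harg
        have e2 := Real.mul_self_sqrt hb.le
        rw [hS]; linear_combination e1 - e2
      congr 1
      rw [div_eq_div_iff h1 hSpos.ne', h2]
      ring
  rw [heq, hφ', ← mul_pow]
  have hsc : 0 < Real.sqrt c := Real.sqrt_pos.2 hc
  -- Each root in `S` is bounded separately: `√b ≥ √c`, and `√(b - c + φ c) ≥ √(φ c)`; both use `c ≤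
  -- b`.
  have hsum : Real.sqrt c * (1 + Real.sqrt φ) ≤ S := by
    rw [mul_add, mul_one, ← Real.sqrt_mul hc.le, hS]
    have h1 := Real.sqrt_le_sqrt hcb
    have h2 : Real.sqrt (c * φ) ≤ Real.sqrt (b - c + φ * c) :=
      Real.sqrt_le_sqrt (by nlinarith)
    linarith
  have hle : c / S * (1 + Real.sqrt φ) ≤ Real.sqrt c := by
    rw [div_mul_eq_mul_div, div_le_iff₀ hSpos]
    calc c * (1 + Real.sqrt φ) = Real.sqrt c * (Real.sqrt c * (1 + Real.sqrt φ)) := by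
          rw [← mul_assoc, Real.mul_self_sqrt hc.le]
      _ ≤ _ := by gcongr
  calc (c / S * (1 + Real.sqrt φ)) ^ 2 ≤ Real.sqrt c ^ 2 := by gcongr
    _ = c := Real.sq_sqrt hc.le

theorem iota3Lo_pos {r₁ b c : ℝ} (hc : 0 < c) (hcb : c ≤ b) : 0 < iota3Lo r₁ b c := by
  have hb : 0 < b := hc.trans_le hcb
  rw [iota3Lo]
  split_ifs with h
  · positivity
  · have h1 : phi1 r₁ b - 1 ≠ 0 := sub_ne_zero.2 h
    have hφ0 : 0 ≤ phi1 r₁ b := by rw [phi1]; positivity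
    have harg : 0 ≤ b - c + phi1 r₁ b * c := by nlinarith [mul_nonneg hφ0 hc.le]
    have h2 : Real.sqrt (b - c + phi1 r₁ b * c) - Real.sqrt b ≠ 0 := by
      intro h3
      have h4 := (Real.sqrt_inj harg hb.le).1 (sub_eq_zero.1 h3)
      apply h1
      have h5 : (phi1 r₁ b - 1) * c = 0 := by linarith
      exact (mul_eq_zero.1 h5).resolve_right hc.ne'
    positivity

end Constants

/-! ### The matrix `Λ̄ᵀ Λ̄`: measurability, bound and quadratic form. -/

namespace Network

variable {n Ny N : ℕ} (S : Network n Ny N)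

/-- `Λ̄ᵀ Λ̄` as the sum of the innovation and the consensus part. -/
noncomputable def gram (t : ℝ) : Matrix (Fin n × Fin N) (Fin n × Fin N) ℝ :=
  diagBlocks (fun i => (S.C i t)ᵀ * S.C i t) + S.α • (S.L t ⊗ₖ (1 : Matrix (Fin N) (Fin N) ℝ))

open Classical in
theorem transpose_Lam_mul (hα : 0 < S.α) (t : ℝ) : (S.Lam t)ᵀ * S.Lam t = S.gram t := by
  rw [Lam, Matrix.transpose_fromRows, Matrix.fromCols_mul_fromRows, Cbar, transpose_diagBlocks_mul,
    gram]
  congr 1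
  rw [Matrix.transpose_smul, Matrix.smul_mul, Matrix.mul_smul, smul_smul, Real.mul_self_sqrt hα.le,
    ← Matrix.kroneckerMap_transpose, ← Matrix.mul_kronecker_mul, Matrix.transpose_transpose,
    Matrix.transpose_one, Matrix.one_mul]
  rfl

theorem transpose_gram (t : ℝ) : (S.gram t)ᵀ = S.gram t := by
  rw [gram, Matrix.transpose_add, Matrix.transpose_smul, ← Matrix.kroneckerMap_transpose,
    Matrix.transpose_one, L, transpose_laplacian, ← transpose_diagBlocks_mul]
  simp

theorem measurable_gramC (hCmeas : ∀ i k l, Measurable fun t => S.C i t k l) (i : Fin n)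
    (k l : Fin N) : Measurable fun t => ((S.C i t)ᵀ * S.C i t) k l := by
  simp only [Matrix.mul_apply, Matrix.transpose_apply]
  exact Finset.measurable_fun_sum _ fun j _ => (hCmeas i j k).mul (hCmeas i j l)

theorem measurable_gram (hCmeas : ∀ i k l, Measurable fun t => S.C i t k l)
    (hGmeas : ∀ i j, MeasurableSet {t | (S.graph t).Adj i j}) (a b : Fin n × Fin N) :
    Measurable fun t => S.gram t a b := by
  obtain ⟨i, k⟩ := a
  obtain ⟨j, l⟩ := b
  simp only [gram, Matrix.add_apply, Matrix.smul_apply, Matrix.kroneckerMap_apply, diagBlocks_apply,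
    smul_eq_mul]
  refine Measurable.add ?_ (((measurable_laplacian hGmeas S.orient i j).mul_const _).const_mul _)
  split_ifs
  · exact S.measurable_gramC hCmeas i k l
  · exact measurable_const

theorem specNorm_gram_le (hα : 0 < S.α) {r₂ r₃ : ℝ} (hr₂ : 0 ≤ r₂) (hr₃ : 0 ≤ r₃) {t : ℝ}
    (hC : ∀ i, specNorm ((S.C i t)ᵀ * S.C i t) ≤ r₂) (hL : specNorm (S.L t) ≤ r₃) :
    specNorm (S.gram t) ≤ r4 S.α r₂ r₃ := by
  rw [gram, specNorm, map_add, map_smul, r4]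
  refine (norm_add_le _ _).trans (add_le_add (specNorm_diagBlocks_le hr₂ hC) ?_)
  rw [norm_smul, Real.norm_of_nonneg hα.le]
  exact mul_le_mul_of_nonneg_left (specNorm_kronecker_le hr₃ hL) hα.le

theorem inner_gram (t : ℝ) (x : EuclideanSpace ℝ (Fin n × Fin N)) :
    inner ℝ x (Matrix.toEuclideanCLM (n := Fin n × Fin N) (𝕜 := ℝ) (S.gram t) x) =
      (∑ i, inner ℝ (blockRow x i)
        (Matrix.toEuclideanCLM (n := Fin N) (𝕜 := ℝ) ((S.C i t)ᵀ * S.C i t) (blockRow x i))) +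
      S.α * ∑ k, inner ℝ (blockCol x k)
        (Matrix.toEuclideanCLM (n := Fin n) (𝕜 := ℝ) (S.L t) (blockCol x k)) := by
  rw [gram, map_add, map_smul, add_apply, smul_apply,
    inner_add_right, real_inner_smul_right, inner_eq_sum_blockRow, inner_eq_sum_blockCol]
  simp only [blockRow_diagBlocks, blockCol_kronecker]

theorem posSemidef_gramC (i : Fin n) (t : ℝ) : ((S.C i t)ᵀ * S.C i t).PosSemidef := by
  rw [← Matrix.conjTranspose_eq_transpose_of_trivial]
  exact Matrix.posSemidef_conjTranspose_mul_self _

theorem inner_gram_nonneg (hα : 0 < S.α) (t : ℝ) (x : EuclideanSpace ℝ (Fin n × Fin N)) :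
    0 ≤ inner ℝ x (Matrix.toEuclideanCLM (n := Fin n × Fin N) (𝕜 := ℝ) (S.gram t) x) := by
  rw [inner_gram]
  refine add_nonneg (Finset.sum_nonneg fun i _ => inner_toEuclideanCLM_nonneg
    (S.posSemidef_gramC i t) _) (mul_nonneg hα.le (Finset.sum_nonneg fun k _ =>
    inner_toEuclideanCLM_nonneg (posSemidef_laplacian (S.orient t)) _))

end Network

/-! ### Cooperative persistent excitation. -/

namespace Network

variable {n Ny N : ℕ} (S : Network n Ny N)

/-- The consensus part of the Gramian controls the deviation of the blocks from their mean. -/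
theorem consensus_integral_ge (hn : 0 < n)
    (hGmeas : ∀ i j, MeasurableSet {t | (S.graph t).Adj i j}) {lam r₃ a b : ℝ} (ha : 0 ≤ a)
    (hab : a ≤ b)
    (hconn : Module.finrank ℝ (Module.End.eigenspace
        (Matrix.toLin' (matIntegral S.L a b)) 0) = 1 ∧
      ∀ μ ∈ spectrum ℝ (matIntegral S.L a b), μ ≠ 0 → lam ≤ μ)
    (hL : ∀ t, 0 ≤ t → specNorm (S.L t) ≤ r₃) (c : EuclideanSpace ℝ (Fin n)) :
    lam * (‖c‖ ^ 2 - (∑ i, c i) ^ 2 / n) ≤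
      ∫ s in a..b, inner ℝ c (Matrix.toEuclideanCLM (n := Fin n) (𝕜 := ℝ) (S.L s) c) := by
  have hint : ∀ i j, IntervalIntegrable (fun t => S.L t i j) volume a b :=
    intervalIntegrable_apply (measurable_laplacian hGmeas S.orient) hL ha hab
  rw [integral_inner_eq hint]
  refine spectral_gap hn ?_ (fun i => ?_) hconn.1 hconn.2 c
  · ext i j
    simp only [matIntegral, Matrix.transpose_apply, Matrix.of_apply]
    congr 1
    ext s
    exact congrFun (congrFun (transpose_laplacian (S.orient s)) i) j
  · simp only [matIntegral, Matrix.of_apply]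
    rw [← intervalIntegral.integral_finsetSum fun j _ => hint i j]
    simp [L, sum_laplacian]

/-- A quadratic form at a perturbed argument. -/
theorem inner_add_ge {B : Matrix (Fin N) (Fin N) ℝ} (hB : B.PosSemidef) {r : ℝ}
    (hr : specNorm B ≤ r) (m y : EuclideanSpace ℝ (Fin N)) :
    inner ℝ m (Matrix.toEuclideanCLM (n := Fin N) (𝕜 := ℝ) B m) - 2 * r * ‖m‖ * ‖y‖ ≤
      inner ℝ (m + y) (Matrix.toEuclideanCLM (n := Fin N) (𝕜 := ℝ) B (m + y)) := by
  have hBT : Bᵀ = B := (Matrix.conjTranspose_eq_transpose_of_trivial B) ▸ hB.1.eq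
  set F := Matrix.toEuclideanCLM (n := Fin N) (𝕜 := ℝ) B with hF
  have h1 : inner ℝ y (F m) = inner ℝ m (F y) := by
    rw [← inner_toEuclideanCLM_symm hBT, real_inner_comm]
  have h2 : 0 ≤ inner ℝ y (F y) := inner_toEuclideanCLM_nonneg hB y
  have h3 : -(r * ‖m‖ * ‖y‖) ≤ inner ℝ m (F y) := by
    have h4 : |inner ℝ m (F y)| ≤ ‖m‖ * ‖F y‖ := abs_real_inner_le_norm _ _
    have h5 : ‖F y‖ ≤ r * ‖y‖ := F.le_of_opNorm_le hr y
    have h6 := mul_le_mul_of_nonneg_left h5 (norm_nonneg m)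
    have h7 := neg_abs_le (inner ℝ m (F y))
    linarith
  rw [map_add, inner_add_left, inner_add_right, inner_add_right, h1]
  linarith

theorem smul_sq_norm_le_inner {M : Matrix (Fin N) (Fin N) ℝ} {k : ℝ}
    (h : (M - k • (1 : Matrix (Fin N) (Fin N) ℝ)).PosSemidef) (x : EuclideanSpace ℝ (Fin N)) :
    k * ‖x‖ ^ 2 ≤ inner ℝ x (Matrix.toEuclideanCLM (n := Fin N) (𝕜 := ℝ) M x) := by
  have h1 := inner_toEuclideanCLM_nonneg h x
  rw [map_sub, map_smul, map_one, sub_apply, smul_apply, inner_sub_right, real_inner_smul_right,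
    one_apply_eq_self, real_inner_self_eq_norm_sq] at h1
  linarith

variable {S}

/-- Cooperative persistent excitation: the lower bound of the Gramian on unit vectors. -/
theorem excitation_unit (hn : 0 < n)
    (hCmeas : ∀ i k l, Measurable fun t => S.C i t k l)
    (hGmeas : ∀ i j, MeasurableSet {t | (S.graph t).Adj i j}) (hα : 0 < S.α)
    {T ι₁ lam r₂ r₃ : ℝ} (hT : 0 < T) (hr₂ : 0 < r₂) {t : ℝ} (ht : 0 ≤ t)
    (hPE : (matIntegral (fun s => ∑ i, (S.C i s)ᵀ * S.C i s) t (t + T)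
        - ι₁ • (1 : Matrix (Fin N) (Fin N) ℝ)).PosSemidef)
    (hC : ∀ t, 0 ≤ t → ∀ i, specNorm ((S.C i t)ᵀ * S.C i t) ≤ r₂)
    (hconn : Module.finrank ℝ (Module.End.eigenspace
        (Matrix.toLin' (matIntegral S.L t (t + T))) 0) = 1 ∧
      ∀ μ ∈ spectrum ℝ (matIntegral S.L t (t + T)), μ ≠ 0 → lam ≤ μ)
    (hL : ∀ t, 0 ≤ t → specNorm (S.L t) ≤ r₃)
    (x : EuclideanSpace ℝ (Fin n × Fin N)) (hx : ‖x‖ = 1) :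
    iota2Lo n N T S.α ι₁ lam r₂ ≤ ∫ s in t..t + T,
      inner ℝ x (Matrix.toEuclideanCLM (n := Fin n × Fin N) (𝕜 := ℝ) (S.gram s) x) := by
  have htT : t ≤ t + T := by linarith
  have hn' : (0 : ℝ) < n := by exact_mod_cast hn
  have hintL : ∀ i j, IntervalIntegrable (fun t => S.L t i j) volume t (t + T) :=
    intervalIntegrable_apply (measurable_laplacian hGmeas S.orient) hL ht htT
  have hintC : ∀ i k l, IntervalIntegrable (fun s => ((S.C i s)ᵀ * S.C i s) k l) volume t (t + T) :=
    fun i => intervalIntegrable_apply (S.measurable_gramC hCmeas i) (fun s hs => hC s hs i) ht htT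
  set m : EuclideanSpace ℝ (Fin N) := (n : ℝ)⁻¹ • ∑ i, blockRow x i with hm
  set y : Fin n → EuclideanSpace ℝ (Fin N) := fun i => blockRow x i - m with hy
  set Y : ℝ := ∑ i, ‖y i‖ ^ 2 with hY
  have hsum : ∑ i, blockRow x i = (n : ℝ) • m := by
    rw [hm, smul_smul, mul_inv_cancel₀ hn'.ne', one_smul]
  have hnorm : ‖x‖ ^ 2 = n * ‖m‖ ^ 2 + Y := by
    have h1 : Y = ∑ i, (‖blockRow x i‖ ^ 2 - 2 * inner ℝ (blockRow x i) m + ‖m‖ ^ 2) :=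
      Finset.sum_congr rfl fun i _ => norm_sub_sq_real _ _
    rw [h1, Finset.sum_add_distrib, Finset.sum_sub_distrib, ← Finset.mul_sum, ← sum_inner, hsum,
      ← sq_norm_eq_sum_blockRow, real_inner_smul_left, real_inner_self_eq_norm_sq]
    simp
    ring
  -- The scaling by `√n` makes `‖a‖²` the share of the unit norm carried by the consensus component,
  -- and `1 - ‖a‖²` that of the deviations.
  set a : EuclideanSpace ℝ (Fin N) := Real.sqrt n • m with ha
  have hnorma : ‖a‖ ^ 2 = n * ‖m‖ ^ 2 := by
    rw [ha, norm_smul, mul_pow, Real.norm_of_nonneg (Real.sqrt_nonneg _), Real.sq_sqrt hn'.le]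
  have hY0 : 0 ≤ Y := Finset.sum_nonneg fun i _ => sq_nonneg _
  have hYa : Y = 1 - ‖a‖ ^ 2 := by rw [hnorma]; rw [hx] at hnorm; linarith
  refine (iota2Lo_le a (by linarith)).trans ?_
  set qC : ℝ → ℝ := fun s => ∑ i, inner ℝ (blockRow x i)
    (Matrix.toEuclideanCLM (n := Fin N) (𝕜 := ℝ) ((S.C i s)ᵀ * S.C i s) (blockRow x i)) with hqC
  set qL : ℝ → ℝ := fun s => ∑ k, inner ℝ (blockCol x k)
    (Matrix.toEuclideanCLM (n := Fin n) (𝕜 := ℝ) (S.L s) (blockCol x k)) with hqL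
  have hiC : IntervalIntegrable qC volume t (t + T) :=
    intervalIntegrable_finsetSum _ fun i _ => intervalIntegrable_inner (hintC i) _
  have hiL : IntervalIntegrable qL volume t (t + T) :=
    intervalIntegrable_finsetSum _ fun k _ => intervalIntegrable_inner hintL _
  have hsplit : ∫ s in t..t + T,
      inner ℝ x (Matrix.toEuclideanCLM (n := Fin n × Fin N) (𝕜 := ℝ) (S.gram s) x) =
      (∫ s in t..t + T, qC s) + S.α * ∫ s in t..t + T, qL s := by
    simp only [inner_gram]
    rw [intervalIntegral.integral_add hiC (hiL.const_mul _), intervalIntegral.integral_const_mul]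
  have hC0 : 0 ≤ ∫ s in t..t + T, qC s := intervalIntegral.integral_nonneg htT fun s _ =>
    Finset.sum_nonneg fun i _ => inner_toEuclideanCLM_nonneg (S.posSemidef_gramC i s) _
  have hL0 : 0 ≤ ∫ s in t..t + T, qL s := intervalIntegral.integral_nonneg htT fun s _ =>
    Finset.sum_nonneg fun k _ => inner_toEuclideanCLM_nonneg (posSemidef_laplacian (S.orient s)) _
  rw [hsplit]
  -- Both parts of the Gramian are nonnegative, so each alone is a lower bound, and so is their
  -- maximum.
  refine max_le ?_ ?_
  · have h1 : lam * Y ≤ ∫ s in t..t + T, qL s := by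
      rw [intervalIntegral.integral_finsetSum fun k _ => intervalIntegrable_inner hintL _]
      have h2 : lam * Y = ∑ k, lam * (‖blockCol x k‖ ^ 2 - (∑ i, blockCol x k i) ^ 2 / n) := by
        rw [← Finset.mul_sum, Finset.sum_sub_distrib, ← sq_norm_eq_sum_blockCol, hnorm]
        have h3 : ∀ k, (∑ i, blockCol x k i) ^ 2 / n = n * m k ^ 2 := by
          intro k
          have h4 : ∑ i, blockCol x k i = n * m k := by
            have := congrArg (fun v : EuclideanSpace ℝ (Fin N) => v k) hsum
            simpa [blockCol, blockRow] using this
          rw [h4]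
          field_simp
        simp only [h3, ← Finset.mul_sum, ← EuclideanSpace.real_norm_sq_eq]
        ring
      rw [h2]
      exact Finset.sum_le_sum fun k _ => S.consensus_integral_ge hn hGmeas ht htT hconn hL _
    rw [← hYa, mul_assoc]
    have := mul_le_mul_of_nonneg_left h1 hα.le
    linarith
  · set qm : ℝ → ℝ := fun s => ∑ i, inner ℝ m
      (Matrix.toEuclideanCLM (n := Fin N) (𝕜 := ℝ) ((S.C i s)ᵀ * S.C i s) m) with hqm
    have him : IntervalIntegrable qm volume t (t + T) :=
      intervalIntegrable_finsetSum _ fun i _ => intervalIntegrable_inner (hintC i) _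
    -- Cauchy-Schwarz over the agents produces a factor `√n`, which the scaling of `a` absorbs.
    have hroot : ‖m‖ * ∑ i, ‖y i‖ ≤ Real.sqrt (‖a‖ ^ 2 * (1 - ‖a‖ ^ 2)) := by
      apply Real.le_sqrt_of_sq_le
      have h1 : (∑ i, ‖y i‖) ^ 2 ≤ n * Y := by
        simpa using sq_sum_le_card_mul_sum_sq (s := Finset.univ) (f := fun i => ‖y i‖)
      rw [mul_pow, ← hYa, hnorma]
      nlinarith [mul_le_mul_of_nonneg_left h1 (sq_nonneg ‖m‖)]
    -- Each block is replaced by the mean at the price of a cross term; `hroot` bounds the sum of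
    -- the cross terms uniformly in time.
    have hmono : ∫ s in t..t + T, (qm s - 2 * r₂ * Real.sqrt (‖a‖ ^ 2 * (1 - ‖a‖ ^ 2))) ≤
        ∫ s in t..t + T, qC s := by
      refine intervalIntegral.integral_mono_on htT (him.sub intervalIntegrable_const) hiC
        fun s hs => ?_
      have h1 : ∀ i, inner ℝ m (Matrix.toEuclideanCLM (n := Fin N) (𝕜 := ℝ) ((S.C i s)ᵀ * S.C i s) m) -
          2 * r₂ * ‖m‖ * ‖y i‖ ≤ inner ℝ (blockRow x i)
            (Matrix.toEuclideanCLM (n := Fin N) (𝕜 := ℝ) ((S.C i s)ᵀ * S.C i s) (blockRow x i)) := by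
        intro i
        have h2 := inner_add_ge (S.posSemidef_gramC i s) (hC s (ht.trans hs.1) i) m (y i)
        have h3 : m + y i = blockRow x i := by simp [hy]
        rwa [h3] at h2
      have h2 := Finset.sum_le_sum fun i (_ : i ∈ Finset.univ) => h1 i
      rw [Finset.sum_sub_distrib, ← Finset.mul_sum] at h2
      have h3 := mul_le_mul_of_nonneg_left hroot hr₂.le
      simp only [hqm, hqC]
      linarith
    rw [intervalIntegral.integral_sub him intervalIntegrable_const, intervalIntegral.integral_const,
      add_sub_cancel_left, smul_eq_mul] at hmono
    have hqmint : ∫ s in t..t + T, qm s = inner ℝ m (Matrix.toEuclideanCLM (n := Fin N) (𝕜 := ℝ)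
        (matIntegral (fun s => ∑ i, (S.C i s)ᵀ * S.C i s) t (t + T)) m) := by
      rw [← integral_inner_eq]
      · congr 1
        ext s
        simp only [hqm]
        rw [map_sum, sum_apply, inner_sum]
      · intro k l
        simp only [Matrix.sum_apply]
        exact intervalIntegrable_finsetSum _ fun i _ => hintC i k l
    have hlow : ι₁ * ‖m‖ ^ 2 ≤ ∫ s in t..t + T, qm s := by
      rw [hqmint]
      exact smul_sq_norm_le_inner hPE m
    have h5 : ι₁ / n * ‖a‖ ^ 2 = ι₁ * ‖m‖ ^ 2 := by rw [hnorma]; field_simp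
    have h6 := mul_nonneg hα.le hL0
    rw [h5]
    linarith

/-- Cooperative persistent excitation: the lower bound of the Gramian. -/
theorem excitation (hn : 0 < n)
    (hCmeas : ∀ i k l, Measurable fun t => S.C i t k l)
    (hGmeas : ∀ i j, MeasurableSet {t | (S.graph t).Adj i j}) (hα : 0 < S.α)
    {T ι₁ lam r₂ r₃ : ℝ} (hT : 0 < T) (hr₂ : 0 < r₂) {t : ℝ} (ht : 0 ≤ t)
    (hPE : (matIntegral (fun s => ∑ i, (S.C i s)ᵀ * S.C i s) t (t + T)
        - ι₁ • (1 : Matrix (Fin N) (Fin N) ℝ)).PosSemidef)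
    (hC : ∀ t, 0 ≤ t → ∀ i, specNorm ((S.C i t)ᵀ * S.C i t) ≤ r₂)
    (hconn : Module.finrank ℝ (Module.End.eigenspace
        (Matrix.toLin' (matIntegral S.L t (t + T))) 0) = 1 ∧
      ∀ μ ∈ spectrum ℝ (matIntegral S.L t (t + T)), μ ≠ 0 → lam ≤ μ)
    (hL : ∀ t, 0 ≤ t → specNorm (S.L t) ≤ r₃)
    (x : EuclideanSpace ℝ (Fin n × Fin N)) :
    iota2Lo n N T S.α ι₁ lam r₂ * ‖x‖ ^ 2 ≤ ∫ s in t..t + T,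
      inner ℝ x (Matrix.toEuclideanCLM (n := Fin n × Fin N) (𝕜 := ℝ) (S.gram s) x) := by
  rcases eq_or_ne x 0 with rfl | hx
  · simp
  have hx' : ‖x‖ ≠ 0 := norm_ne_zero_iff.2 hx
  have h := excitation_unit hn hCmeas hGmeas hα hT hr₂ ht hPE hC hconn hL (‖x‖⁻¹ • x)
    (by rw [norm_smul, norm_inv, norm_norm, inv_mul_cancel₀ hx'])
  simp only [map_smul, real_inner_smul_left, real_inner_smul_right,
    intervalIntegral.integral_const_mul] at h
  calc _ ≤ (‖x‖⁻¹ * (‖x‖⁻¹ * ∫ s in t..t + T,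
      inner ℝ x (Matrix.toEuclideanCLM (n := Fin n × Fin N) (𝕜 := ℝ) (S.gram s) x))) * ‖x‖ ^ 2 := by
        gcongr
    _ = _ := by field_simp

end Network

end CIEstimator

/-! ### Specialisation to the estimator. -/

open CIEstimator in
theorem corollary2 {n Ny N : ℕ} (hn : 0 < n) (hN : 0 < N) (S : CIEstimator.Network n Ny N)
    -- measurable dependence of the regressors and of the graph on time
    (hCmeas : ∀ i k l, Measurable fun t => S.C i t k l)
    (hGmeas : ∀ i j, MeasurableSet {t | (S.graph t).Adj i j})
    -- the gains
    (hΓ : ∀ i, (S.Γ i).PosDef) (hα : 0 < S.α)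
    -- the constants
    (T ι₁ ι₁' lam r₂ r₃ : ℝ)
    (hT : 0 < T) (hι₁ : 0 < ι₁) (hι₁' : ι₁ ≤ ι₁') (hlam : 0 < lam) (hr₂ : 0 < r₂) (hr₃ : 0 < r₃)
    -- cooperative persistent excitation
    (hPE : ∀ t, T ≤ t →
      (CIEstimator.matIntegral (fun s => ∑ i, (S.C i s)ᵀ * S.C i s) (t - T) t
        - ι₁ • (1 : Matrix (Fin N) (Fin N) ℝ)).PosSemidef ∧
      (ι₁' • (1 : Matrix (Fin N) (Fin N) ℝ)
        - CIEstimator.matIntegral (fun s => ∑ i, (S.C i s)ᵀ * S.C i s) (t - T) t).PosSemidef)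
    -- bounded regressors
    (hC : ∀ t, 0 ≤ t → ∀ i, CIEstimator.specNorm ((S.C i t)ᵀ * S.C i t) ≤ r₂)
    -- connectedness on average and bounded Laplacian
    (hconn : ∀ t, T ≤ t →
      Module.finrank ℝ (Module.End.eigenspace
        (Matrix.toLin' (CIEstimator.matIntegral S.L (t - T) t)) 0) = 1 ∧
      ∀ μ ∈ spectrum ℝ (CIEstimator.matIntegral S.L (t - T) t), μ ≠ 0 → lam ≤ μ)
    (hL : ∀ t, 0 ≤ t → CIEstimator.specNorm (S.L t) ≤ r₃) :
    let r₁ := CIEstimator.specNorm S.Gam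
    let b₂ := CIEstimator.iota2Up T S.α r₂ r₃
    let c₂ := CIEstimator.iota2Lo n N T S.α ι₁ lam r₂
    let c₃ := CIEstimator.iota3Lo r₁ b₂ c₂
    let κ₁ := CIEstimator.kappa1 T S.Gam (CIEstimator.iota3Up r₁ b₂ c₂)
    let κ₂ := CIEstimator.kappa2 T S.Gam
    CIEstimator.IsISS S.errorField ∧
    CIEstimator.IsISSGain S.errorField (2 * κ₁ / c₃ * Real.sqrt (κ₁ / κ₂)) ∧
    CIEstimator.issGain S.errorField ≤ 2 * κ₁ / c₃ * Real.sqrt (κ₁ / κ₂) := by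
  intro r₁ b₂ c₂ c₃ κ₁ κ₂
  have : NeZero n := ⟨hn.ne'⟩
  have : NeZero N := ⟨hN.ne'⟩
  have hG : S.Gam.PosDef := posDef_diagBlocks hΓ
  have hGi : S.Gam⁻¹.PosDef := hG.inv
  have hGiT : (S.Gam⁻¹)ᵀ = S.Gam⁻¹ :=
    (Matrix.conjTranspose_eq_transpose_of_trivial S.Gam⁻¹) ▸ hGi.1.eq
  have hr4 : 0 < r4 S.α r₂ r₃ := add_pos hr₂ (mul_pos hα hr₃)
  have hc₂ : 0 < c₂ := iota2Lo_pos hn hα hι₁ hlam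
  have hnormA : ∀ t, 0 ≤ t → specNorm (S.gram t) ≤ r4 S.α r₂ r₃ := fun t ht =>
    S.specNorm_gram_le hα hr₂.le hr₃.le (hC t ht) (hL t ht)
  obtain ⟨x₁, hx₁⟩ := exists_ne (0 : EuclideanSpace ℝ (Fin n × Fin N))
  have hinv : ∀ x, Matrix.toEuclideanCLM (n := Fin n × Fin N) (𝕜 := ℝ) S.Gam⁻¹
      (Matrix.toEuclideanCLM (n := Fin n × Fin N) (𝕜 := ℝ) S.Gam x) = x := by
    intro x
    rw [← mul_apply_eq_comp, ← map_mul,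
      Matrix.nonsing_inv_mul _ ((Matrix.isUnit_iff_isUnit_det _).1 hG.isUnit), map_one]
    rfl
  have hr₁ : 0 < r₁ := by
    refine norm_pos_iff.2 fun h => hx₁ ?_
    rw [← hinv x₁, h]
    simp
  have hflow : GradFlow (Matrix.toEuclideanCLM (n := Fin n × Fin N) (𝕜 := ℝ) S.Gam)
      (Matrix.toEuclideanCLM (n := Fin n × Fin N) (𝕜 := ℝ) S.Gam⁻¹)
      (fun t => Matrix.toEuclideanCLM (n := Fin n × Fin N) (𝕜 := ℝ) (S.gram t))
      (lambdaMin S.Gam⁻¹) (lambdaMax S.Gam⁻¹) r₁ (r4 S.α r₂ r₃) c₂ T :=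
    { inv := hinv
      symm_Q := inner_toEuclideanCLM_symm hGiT
      p_pos := lambdaMin_pos hGi
      lower_Q := lambdaMin_le_inner hGi.1
      upper_Q := inner_le_lambdaMax hGi.1
      norm_Γ := le_rfl
      r₁_pos := hr₁
      r_pos := hr4
      meas := stronglyMeasurable_toEuclideanCLM (S.measurable_gram hCmeas hGmeas)
      symm_A := fun t => inner_toEuclideanCLM_symm (S.transpose_gram t)
      nonneg_A := S.inner_gram_nonneg hα
      norm_A := hnormA
      T_pos := hT
      excite := by
        intro t ht x
        have h1 := hPE (t + T) (by linarith)
        have h2 := hconn (t + T) (by linarith)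
        rw [add_sub_cancel_right] at h1 h2
        exact Network.excitation hn hCmeas hGmeas hα hT hr₂ ht h1.1 hC h2 hL x }
  -- Both numbers bound the same Gramian form at a nonzero vector, from below by excitation and from
  -- above by the pointwise norm bound.
  have hcb : c₂ ≤ b₂ := by
    have h1 := hflow.excite 0 le_rfl x₁
    have h2 : ∫ s in (0 : ℝ)..0 + T, inner ℝ x₁
        (Matrix.toEuclideanCLM (n := Fin n × Fin N) (𝕜 := ℝ) (S.gram s) x₁) ≤
        ∫ s in (0 : ℝ)..0 + T, r4 S.α r₂ r₃ * ‖x₁‖ ^ 2 :=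
      intervalIntegral.integral_mono_on (by linarith)
        (hflow.integrable_quad le_rfl (by linarith) continuousOn_const) intervalIntegrable_const
        fun s hs => hflow.inner_le hs.1 x₁
    rw [intervalIntegral.integral_const, zero_add, sub_zero, smul_eq_mul, ← mul_assoc] at h2
    rw [zero_add] at h1
    exact le_of_mul_le_mul_right (h1.trans h2) (by positivity)
  have hc₃ : 0 < c₃ := iota3Lo_pos hc₂ hcb
  have hfield : S.errorField = gradField (Matrix.toEuclideanCLM (n := Fin n × Fin N) (𝕜 := ℝ) S.Gam)
      (fun t => Matrix.toEuclideanCLM (n := Fin n × Fin N) (𝕜 := ℝ) (S.gram t)) := by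
    classical
    funext t x u
    rw [Network.errorField, gradField, Matrix.mul_assoc, S.transpose_Lam_mul hα, map_neg, map_mul]
    rfl
  have hP : 0 < lambdaMax S.Gam⁻¹ := hflow.P_pos
  have hp : 0 < lambdaMin S.Gam⁻¹ := hflow.p_pos
  have hκ₁ : T / 2 * lambdaMax S.Gam⁻¹ ≤ κ₁ := by
    have h1 : 0 ≤ iota3Up r₁ b₂ c₂ := sq_nonneg _
    have h2 : 0 ≤ T * iota3Up r₁ b₂ c₂ := mul_nonneg hT.le h1
    show _ ≤ T / 2 * lambdaMax S.Gam⁻¹ + T * iota3Up r₁ b₂ c₂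
    linarith
  have hκ₂ : κ₂ = T / 2 * lambdaMin S.Gam⁻¹ := rfl
  have hgain : IsISSGain S.errorField (2 * κ₁ / c₃ * Real.sqrt (κ₁ / κ₂)) := by
    rw [hfield]
    refine hflow.isISSGain hc₃ (iota3Lo_mul_le hc₂ hcb) ?_
    have h1 : T * lambdaMax S.Gam⁻¹ / c₃ ≤ 2 * κ₁ / c₃ :=
      div_le_div_of_nonneg_right (by linarith) hc₃.le
    have h2 : lambdaMax S.Gam⁻¹ / lambdaMin S.Gam⁻¹ ≤ κ₁ / κ₂ := by
      rw [hκ₂, div_le_div_iff₀ hp (by positivity)]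
      have := mul_le_mul_of_nonneg_right hκ₁ hp.le
      linarith
    have h3 : 0 ≤ T * lambdaMax S.Gam⁻¹ / c₃ := by positivity
    exact mul_le_mul h1 (Real.sqrt_le_sqrt h2) (Real.sqrt_nonneg _) (h3.trans h1)
  -- Admissible gains are positive by definition, so their infimum is bounded below and lies under
  -- `g`.
  refine ⟨?_, hgain, csInf_le ⟨0, fun g hg => hg.1.le⟩ hgain⟩
  obtain ⟨hg, β, hβ, hest⟩ := hgain
  refine ⟨β, _, hβ, ⟨by fun_prop, fun a _ b _ hab => mul_lt_mul_of_pos_left hab hg, by simp⟩, hest⟩
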